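/- Let $b\ge 2$ and $0<s<b$ be integers and let $\lambda_1,\lambda_2,\mu,\nu>0$. Let $Z=(X_1(t),X_2(t),Y(t))_{t\ge 0}$ be the queueing-inventory process with two customer classes under preemptive-resume priority and flexible admission control with threshold $s$ and priority parameter $p\in[0,1]$, that is, the regular (non-explosive, right-continuous with left limits) time-homogeneous Markov jump process on $$E=\mathbb N_0\times\mathbb N_0\times\{0,1,\dots,b\}$$ (numbers of priority and of ordinary customers in the system, and on-hand inventory) with transition rates, for $(n_1,n_2,k)\in E$, $$\begin{aligned} q((n_1,n_2,k);(n_1+1,n_2,k)) &= \lambda_1 1_{\{k>0\}},\\ q((n_1,n_2,k);(n_1,n_2+1,k)) &= p\lambda_2 1_{\{0<k\le s\}}+\lambda_2 1_{\{k>s\}},\\ q((n_1,n_2,k);(n_1-1,n_2,k-1)) &= \mu 1_{\{n_1>0\}}1_{\{k>0\}},\\ q((n_1,n_2,k);(n_1,n_2-1,k-1)) &= \mu 1_{\{n_1=0\}}1_{\{n_2>0\}}1_{\{k>0\}},\\ q((n_1,n_2,k);(n_1,n_2,k+1)) &= \nu 1_{\{k<b\}}, \end{aligned}$$ $q(z;\tilde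 z)=0$ for every other pair $z\ne\tilde z$, and $q(z;z)=-\sum_{\tilde z\ne z}q(z;\tilde z)$. Call $Z$ ergodic if it is irreducible and there is a probability distribution $\pi$ on $E$ that is stationary for $Z$ and satisfies $\lim_{t\to\infty}P(Z(t)=z\mid Z(0)=z_0)=\pi(z)$ for all $z_0,z\in E$. Suppose that $p=1$, i.e. that ordinary (low-priority) customers are admitted whenever the inventory is not depleted. Then $Z$ is ergodic if and only if $\lambda_1+\lambda_2<\mu$. -/

import Mathlib

open MeasureTheory Filter Topology
open scoped NNReal ENNReal

/-- A Markov jump process on a countable discrete state space `E` with intensity matrix `Q`, given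
as a Markov family: `P x` is the law on `Ω` under which the process `Z` starts in `x`.
Paths are right-continuous with left limits in the discrete space `E`, so that there are only
finitely many jumps in bounded time (non-explosion). -/
structure IsMarkovJumpProcess {E : Type*} [Countable E] [TopologicalSpace E] [DiscreteTopology E]
    [MeasurableSpace E] [DiscreteMeasurableSpace E] [DecidableEq E]
    {Ω : Type*} [MeasurableSpace Ω]
    (Q : E → E → ℝ) (P : E → Measure Ω) (Z : ℝ≥0 → Ω → E) : Prop where
  isProbabilityMeasure : ∀ x, IsProbabilityMeasure (P x)
  measurable : ∀ t, Measurable (Z t)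
  rightContinuous : ∀ ω t, ContinuousWithinAt (fun u => Z u ω) (Set.Ici t) t
  leftLimits : ∀ ω t, ∃ l, Tendsto (fun u => Z u ω) (𝓝[<] t) (𝓝 l)
  initial : ∀ x, P x {ω | Z 0 ω = x} = 1
  /-- The time-homogeneous Markov property with respect to the natural filtration of `Z`. -/
  markov : ∀ (x : E) (s t : ℝ≥0) (A : Set Ω),
    MeasurableSet[⨆ u : Set.Iic s, MeasurableSpace.comap (Z u) inferInstance] A →
    ∀ y z : E, P x (A ∩ {ω | Z s ω = y} ∩ {ω | Z (s + t) ω = z}) =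
      P x (A ∩ {ω | Z s ω = y}) * P y {ω | Z t ω = z}
  /-- `Q` is the derivative at time `0` of the transition probabilities. -/
  generator : ∀ x y : E,
    Tendsto (fun h : ℝ≥0 => ((P x {ω | Z h ω = y}).toReal - (if x = y then 1 else 0)) / (h : ℝ))
      (𝓝[>] 0) (𝓝 (Q x y))

/-- Ergodicity of a Markov jump process: it is irreducible and has a probability distribution `π`
that is stationary and is the limiting distribution from every initial state. -/
structure IsErgodicProcess {E : Type*} {Ω : Type*} [MeasurableSpace Ω]
    (P : E → Measure Ω) (Z : ℝ≥0 → Ω → E) : Prop where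
  irreducible : ∀ x y : E, ∃ t, 0 < P x {ω | Z t ω = y}
  limiting : ∃ π : PMF E,
    (∀ (t : ℝ≥0) (y : E), ∑' x, π x * P x {ω | Z t ω = y} = π y) ∧
    ∀ x y : E, Tendsto (fun t : ℝ≥0 => P x {ω | Z t ω = y}) atTop (𝓝 (π y))

/-- States `(n₁, n₂, k)`: numbers of priority and of ordinary customers in the system, and
on-hand inventory `k ∈ {0, …, b}`. -/
abbrev QIState (b : ℕ) : Type := ℕ × ℕ × Fin (b + 1)

/-- Transition rates between distinct states of the queueing-inventory process with base stock
level `b`, threshold `s`, arrival rates `lam₁`, `lam₂`, service rate `mu`, replenishment rate `nu`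
and priority parameter `p`. -/
noncomputable def qiRate (b s : ℕ) (lam₁ lam₂ mu nu p : ℝ) : QIState b → QIState b → ℝ
  | (n₁, n₂, k), (m₁, m₂, l) =>
    if m₁ = n₁ + 1 ∧ m₂ = n₂ ∧ l = k then
      (if 0 < (k : ℕ) then lam₁ else 0)
    else if m₁ = n₁ ∧ m₂ = n₂ + 1 ∧ l = k then
      (if 0 < (k : ℕ) ∧ (k : ℕ) ≤ s then p * lam₂ else 0) + (if s < (k : ℕ) then lam₂ else 0)
    else if m₁ + 1 = n₁ ∧ m₂ = n₂ ∧ (l : ℕ) + 1 = k then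
      mu
    else if m₁ = n₁ ∧ m₂ + 1 = n₂ ∧ (l : ℕ) + 1 = k then
      (if n₁ = 0 then mu else 0)
    else if m₁ = n₁ ∧ m₂ = n₂ ∧ (l : ℕ) = k + 1 then
      nu
    else 0

/-- The intensity matrix of the queueing-inventory process: the rates `qiRate` off the diagonal,
and row sums zero (each row has only finitely many non-zero entries). -/
noncomputable def qiGenerator (b s : ℕ) (lam₁ lam₂ mu nu p : ℝ) (z w : QIState b) : ℝ :=
  if z = w then -∑' v : {v : QIState b // v ≠ z}, qiRate b s lam₁ lam₂ mu nu p z v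
  else qiRate b s lam₁ lam₂ mu nu p z w

theorem qiRate_support_finite (b s : ℕ) (lam₁ lam₂ mu nu p : ℝ) (z : QIState b) :
    (Function.support (qiRate b s lam₁ lam₂ mu nu p z)).Finite := by
  obtain ⟨n₁, n₂, k⟩ := z
  refine Set.Finite.subset
    ((Set.finite_Iic (n₁ + 1)).prod ((Set.finite_Iic (n₂ + 1)).prod Set.finite_univ)) ?_
  rintro ⟨m₁, m₂, l⟩ h
  simp only [Set.mem_prod, Set.mem_Iic, Set.mem_univ, and_true]
  by_contra hc
  apply h
  have h1 : ¬ (m₁ = n₁ + 1 ∧ m₂ = n₂ ∧ l = k) := by omega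
  have h2 : ¬ (m₁ = n₁ ∧ m₂ = n₂ + 1 ∧ l = k) := by omega
  have h3 : ¬ (m₁ + 1 = n₁ ∧ m₂ = n₂ ∧ (l : ℕ) + 1 = k) := by omega
  have h4 : ¬ (m₁ = n₁ ∧ m₂ + 1 = n₂ ∧ (l : ℕ) + 1 = k) := by omega
  have h5 : ¬ (m₁ = n₁ ∧ m₂ = n₂ ∧ (l : ℕ) = k + 1) := by omega
  simp only [qiRate, h1, h2, h3, h4, h5, if_false]

/-!
The proof rests on one observation: for `p = 1` the process has four moves `x ↦ τ i x` (two kinds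
of arrival, service, replenishment) that are applied at constant rates `r i`, a blocked move being
the identity. Its generator is therefore the bounded operator
`L f = ∑ i, r i * (f ∘ τ i - f)` (`jumpGenerator`), and the pair (total number of customers,
inventory) is a process of the same kind, since service always reduces the total by one.

**From the process to the generator.** The transition probabilities form a semigroup of Markov
kernels whose derivative at `0` is known entrywise only. Subadditivity bounds the probability of
not being in the initial state by a constant times the time, uniformly in the state
(`IsJumpSemigroup.one_sub_apply_self_le`). Hence a probability measure `π` is stationary if and only
if `∫ L f dπ = 0` for all bounded `f` (`IsJumpSemigroup.integral_jumpGenerator_eq_zero` and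
`IsJumpSemigroup.invariant_of_integral_jumpGenerator_eq_zero`).

**Necessity.** Testing a stationary law on the event `total ≤ n` gives
`λ * P(total = n, inventory > 0) = μ * P(total = n + 1, inventory > 0)` with `λ = λ₁ + λ₂` and
`μ` the service rate. These probabilities are positive and summable, so `λ < μ`
(`lam_lt_mu_of_equilibrium`).

**Sufficiency.** The pair (total, inventory) has the product-form equilibrium
`m (n, k) ∝ (λ / μ) ^ n * (ν / λ) ^ k` (`exists_totalMove_equilibrium`). No closed form is used for
the full process. Its laws that project onto `m` are preserved by the uniformised chain and are
dominated by `m (n₁ + n₂, k)`, which is summable over the states because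
`∑ n, (n + 1) * (λ / μ) ^ n < ∞`. So the Krylov–Bogoliubov averages have a limit point of full mass,
which is an equilibrium (`exists_integral_jumpGenerator_eq_zero`).

**Convergence.** All transition probabilities at positive times are positive
(`IsJumpSemigroup.apply_pos_of_reflTransGen`, `qiReach`). A strictly positive stochastic matrix
strictly decreases the `ℓ¹`-norm of a signed measure of total mass zero, and the laws of the process
started from a point are dominated by a multiple of the equilibrium, so a compactness argument gives
convergence (`IsJumpSemigroup.tendsto_apply`).
-/

open ProbabilityTheory

/-! ### Jump semigroups with constant rates and their generators -/

theorem integral_kernel_bind {E : Type*} [MeasurableSpace E] {κ : Kernel E E} [IsMarkovKernel κ]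
    {μ : Measure E} [IsProbabilityMeasure μ] {f : E → ℝ} (hf : Integrable f (μ.bind κ)) :
    ∫ x, f x ∂(μ.bind κ) = ∫ x, ∫ y, f y ∂κ x ∂μ := by
  have h : (κ ∘ₖ Kernel.const Unit μ) () = μ.bind κ := by
    rw [Kernel.comp_const, Kernel.const_apply]
  rw [← h] at hf ⊢
  rw [Kernel.integral_comp hf, Kernel.const_apply]

theorem integrable_of_abs_le {E : Type*} [MeasurableSpace E] [DiscreteMeasurableSpace E]
    {μ : Measure E} [IsFiniteMeasure μ] {f : E → ℝ} {B : ℝ} (hB : ∀ x, |f x| ≤ B) :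
    Integrable f μ :=
  Integrable.of_bound (C := B) (Measurable.of_discrete).aestronglyMeasurable
    (Eventually.of_forall hB)

theorem abs_integral_le_of_abs_le {E : Type*} [MeasurableSpace E] {μ : Measure E}
    [IsProbabilityMeasure μ] {f : E → ℝ} {B : ℝ} (hB : ∀ x, |f x| ≤ B) : |∫ x, f x ∂μ| ≤ B := by
  have h : ‖∫ x, f x ∂μ‖ ≤ B * μ.real Set.univ :=
    norm_integral_le_of_norm_le_const (Eventually.of_forall hB)
  simpa using h

/-- A semigroup of Markov kernels on a countable discrete space in which, for each `i`, the state
`x` jumps to `τ i x` at the constant rate `r i`; a move that is blocked at `x` is encoded by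
`τ i x = x`. -/
structure IsJumpSemigroup {E ι : Type*} [MeasurableSpace E] [DecidableEq E] [Fintype ι]
    (r : ι → ℝ) (τ : ι → E → E) (κ : ℝ≥0 → Kernel E E) : Prop where
  markov : ∀ t, IsMarkovKernel (κ t)
  rate_nonneg : ∀ i, 0 ≤ r i
  zero : κ 0 = Kernel.id
  add : ∀ s t, κ (s + t) = κ t ∘ₖ κ s
  generator : ∀ x y, Tendsto
    (fun h : ℝ≥0 => ((κ h x).real {y} - if x = y then 1 else 0) / (h : ℝ)) (𝓝[>] 0)
    (𝓝 (∑ i, r i * ((if τ i x = y then 1 else 0) - if x = y then 1 else 0)))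

/-- The generator `f ↦ ∑ i, r i * (f ∘ τ i - f)` of the jump process with moves `τ` at rates
`r`. -/
def jumpGenerator {E ι : Type*} [Fintype ι] (r : ι → ℝ) (τ : ι → E → E) (f : E → ℝ) (x : E) : ℝ :=
  ∑ i, r i * (f (τ i x) - f x)

theorem abs_jumpGenerator_le {E ι : Type*} [Fintype ι] {r : ι → ℝ} {τ : ι → E → E}
    (hr : ∀ i, 0 ≤ r i) {f : E → ℝ} {B : ℝ} (hB : ∀ x, |f x| ≤ B) (x : E) :
    |jumpGenerator r τ f x| ≤ 2 * B * ∑ i, r i := by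
  rw [jumpGenerator, Finset.mul_sum]
  refine (Finset.abs_sum_le_sum_abs _ _).trans (Finset.sum_le_sum fun i _ => ?_)
  rw [abs_mul, abs_of_nonneg (hr i), mul_comm]
  exact mul_le_mul_of_nonneg_right
    ((abs_sub _ _).trans (by linarith [hB x, hB (τ i x)])) (hr i)

namespace IsJumpSemigroup

variable {E ι : Type*} [Countable E] [MeasurableSpace E] [DiscreteMeasurableSpace E]
  [DecidableEq E] [Fintype ι] {r : ι → ℝ} {τ : ι → E → E} {κ : ℝ≥0 → Kernel E E}

theorem mul_le_apply_add (hκ : IsJumpSemigroup r τ κ) (s t : ℝ≥0) (x y z : E) :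
    (κ s x).real {y} * (κ t y).real {z} ≤ (κ (s + t) x).real {z} := by
  have := hκ.markov
  have h : (κ s x) {y} * (κ t y) {z} ≤ (κ (s + t) x) {z} := by
    rw [hκ.add, Kernel.comp_apply' _ _ _ (MeasurableSet.singleton z), mul_comm,
      ← lintegral_singleton (μ := κ s x) (fun b => κ t b {z}) y]
    exact setLIntegral_le_lintegral _ _
  rw [measureReal_def, measureReal_def, measureReal_def, ← ENNReal.toReal_mul]
  exact ENNReal.toReal_mono (measure_ne_top _ _) h

theorem apply_zero_self (hκ : IsJumpSemigroup r τ κ) (x : E) : (κ 0 x).real {x} = 1 := by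
  simp [hκ.zero, Kernel.id_apply, measureReal_def]

/-- The probability of not being in `x` at time `h` is subadditive in `h`, hence it is at most `h`
times its derivative at `0`, which gives a bound that is uniform in `x`. -/
theorem one_sub_apply_self_le (hκ : IsJumpSemigroup r τ κ) (h : ℝ≥0) (x : E) :
    1 - (κ h x).real {x} ≤ (∑ i, r i) * h := by
  have := hκ.markov
  rcases eq_or_ne h 0 with rfl | hh
  · simp [hκ.apply_zero_self]
  have hsub : ∀ (n : ℕ) (u : ℝ≥0), 1 - (κ (n * u) x).real {x} ≤ n * (1 - (κ u x).real {x}) := by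
    intro n u
    induction n with
    | zero => simp [hκ.apply_zero_self]
    | succ n ih =>
      have h1 := hκ.mul_le_apply_add (n * u) u x x x
      have h2 : (κ (n * u) x).real {x} ≤ 1 := measureReal_le_one
      have h3 : (κ u x).real {x} ≤ 1 := measureReal_le_one
      push_cast
      rw [add_mul, one_mul]
      nlinarith [mul_nonneg (sub_nonneg.2 h2) (sub_nonneg.2 h3)]
  have hpos : (0 : ℝ) < h := by positivity
  -- Apply subadditivity to `n + 1` steps of length `h / (n + 1)` and let `n → ∞`.
  have hlim : Tendsto (fun n : ℕ => h / ((n : ℝ≥0) + 1)) atTop (𝓝[>] 0) := by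
    refine tendsto_nhdsWithin_iff.2 ⟨?_, Eventually.of_forall fun n => ?_⟩
    · rw [← NNReal.tendsto_coe]
      push_cast
      simpa [Function.comp_def] using
        (tendsto_const_div_atTop_nhds_zero_nat (h : ℝ)).comp (tendsto_add_atTop_nat 1)
    · exact Set.mem_Ioi.2 (by positivity)
  have hlim2 := ((hκ.generator x x).comp hlim).neg.const_mul (h : ℝ)
  have hle : 1 - (κ h x).real {x} ≤
      h * -∑ i, r i * ((if τ i x = x then 1 else 0) - if x = x then 1 else 0) := by
    refine ge_of_tendsto' hlim2 fun n => ?_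
    have h1 := hsub (n + 1) (h / (n + 1))
    have h2 : ((n + 1 : ℕ) : ℝ≥0) * (h / (n + 1)) = h := by
      push_cast
      field_simp
    rw [h2] at h1
    refine h1.trans (le_of_eq ?_)
    simp only [Function.comp_apply, if_true]
    push_cast
    field_simp
    ring
  refine hle.trans ?_
  rw [mul_comm, ← Finset.sum_neg_distrib]
  refine mul_le_mul_of_nonneg_right (Finset.sum_le_sum fun i _ => ?_) hpos.le
  have := hκ.rate_nonneg i
  split_ifs <;> simp <;> linarith

theorem abs_integral_sub_le (hκ : IsJumpSemigroup r τ κ) {f : E → ℝ} {B : ℝ}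
    (hB : ∀ x, |f x| ≤ B) (h : ℝ≥0) (x : E) :
    |∫ y, f y ∂κ h x - f x| ≤ 2 * B * (∑ i, r i) * h := by
  have := hκ.markov
  have hB0 : 0 ≤ B := (abs_nonneg _).trans (hB x)
  have hi : Integrable f (κ h x) := integrable_of_abs_le hB
  have hi' : Integrable (fun y => f y - f x) (κ h x) := hi.sub (integrable_const _)
  have h1 : ∫ y, f y ∂κ h x - f x = ∫ y in {x}ᶜ, (f y - f x) ∂κ h x := by
    have h2 : ∫ y, (f y - f x) ∂κ h x = ∫ y, f y ∂κ h x - f x := by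
      rw [integral_sub hi (integrable_const _)]
      simp
    rw [← h2, ← integral_add_compl (MeasurableSet.singleton x) hi']
    simp
  have h3 : ‖∫ y in {x}ᶜ, (f y - f x) ∂κ h x‖ ≤ 2 * B * (κ h x).real {x}ᶜ :=
    norm_setIntegral_le_of_norm_le_const (measure_lt_top _ _) fun y _ =>
      (abs_sub _ _).trans (by linarith [hB x, hB y])
  rw [h1]
  refine h3.trans ?_
  rw [probReal_compl_eq_one_sub (MeasurableSet.singleton x), mul_assoc (2 * B)]
  exact mul_le_mul_of_nonneg_left (hκ.one_sub_apply_self_le h x) (by positivity)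

/-- Each row of the intensity matrix has finite support and sum zero, so the derivative at time `0`
passes from the single transition probabilities to all bounded functions. -/
theorem tendsto_integral_sub_div (hκ : IsJumpSemigroup r τ κ) {f : E → ℝ} {B : ℝ}
    (hB : ∀ x, |f x| ≤ B) (x : E) :
    Tendsto (fun h : ℝ≥0 => (∫ y, f y ∂κ h x - f x) / (h : ℝ)) (𝓝[>] 0)
      (𝓝 (jumpGenerator r τ f x)) := by
  have := hκ.markov
  classical
  -- The support of row `x` of the intensity matrix.
  let F : Finset E := insert x (Finset.univ.image fun i => τ i x)
  have hxF : x ∈ F := Finset.mem_insert_self _ _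
  have hτF : ∀ i, τ i x ∈ F := fun i =>
    Finset.mem_insert_of_mem (Finset.mem_image_of_mem _ (Finset.mem_univ i))
  have hsum : ∀ g : E → ℝ, Tendsto (fun h : ℝ≥0 => ∑ y ∈ F,
      g y * (((κ h x).real {y} - if x = y then 1 else 0) / (h : ℝ))) (𝓝[>] 0)
      (𝓝 (jumpGenerator r τ g x)) := by
    intro g
    have h1 := tendsto_finsetSum F fun y _ => (hκ.generator x y).const_mul (g y)
    convert h1 using 2
    simp_rw [Finset.mul_sum]
    rw [Finset.sum_comm]
    refine Finset.sum_congr rfl fun i _ => ?_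
    have h2 : ∀ y, g y * (r i * ((if τ i x = y then 1 else 0) - if x = y then 1 else 0)) =
        r i * ((if τ i x = y then g y else 0) - if x = y then g y else 0) := by
      intro y
      split_ifs <;> ring
    simp_rw [h2]
    rw [← Finset.mul_sum, Finset.sum_sub_distrib, Finset.sum_ite_eq, Finset.sum_ite_eq,
      if_pos hxF, if_pos (hτF i)]
  have hB0 : 0 ≤ B := (abs_nonneg _).trans (hB x)
  -- The mass outside `F` is `1` minus the mass of `F`, whose derivative at `0` vanishes.
  have hrem : Tendsto (fun h : ℝ≥0 => (∫ y in (F : Set E)ᶜ, (f y - f x) ∂κ h x) / (h : ℝ))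
      (𝓝[>] 0) (𝓝 0) := by
    have h0 := ((hsum fun _ => 1).neg.const_mul (2 * B))
    simp only [jumpGenerator, sub_self, mul_zero, Finset.sum_const_zero, neg_zero] at h0
    refine squeeze_zero_norm (fun h => ?_) h0
    rw [norm_div, Real.norm_of_nonneg (NNReal.coe_nonneg h)]
    have h1 : ‖∫ y in (F : Set E)ᶜ, (f y - f x) ∂κ h x‖ ≤ 2 * B * (κ h x).real (F : Set E)ᶜ :=
      norm_setIntegral_le_of_norm_le_const (measure_lt_top _ _) fun y _ =>
        (abs_sub _ _).trans (by linarith [hB x, hB y])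
    refine (div_le_div_of_nonneg_right h1 (NNReal.coe_nonneg h)).trans (le_of_eq ?_)
    rw [probReal_compl_eq_one_sub (Finset.measurableSet F), ← sum_measureReal_singleton]
    simp only [one_mul]
    rw [← Finset.sum_div, Finset.sum_sub_distrib, Finset.sum_ite_eq, if_pos hxF]
    ring
  have hmain := (hsum fun y => f y - f x).add hrem
  have hgen : jumpGenerator r τ (fun y => f y - f x) x + 0 = jumpGenerator r τ f x := by
    simp [jumpGenerator]
  rw [hgen] at hmain
  refine hmain.congr fun h => ?_
  have hi : Integrable f (κ h x) := integrable_of_abs_le hB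
  have hi' : Integrable (fun y => f y - f x) (κ h x) := hi.sub (integrable_const _)
  have h2 : ∫ y, f y ∂κ h x - f x = ∫ y, (f y - f x) ∂κ h x := by
    rw [integral_sub hi (integrable_const _)]
    simp
  rw [h2, ← integral_add_compl (Finset.measurableSet F) hi', setIntegral_finset F hi'.integrableOn,
    add_div, Finset.sum_div]
  congr 1
  refine Finset.sum_congr rfl fun y _ => ?_
  rcases eq_or_ne x y with rfl | hxy
  · simp
  · simp only [hxy, if_false, sub_zero, smul_eq_mul]
    ring

end IsJumpSemigroup

namespace IsJumpSemigroup

theorem integral_add {E ι : Type*} [MeasurableSpace E] [DiscreteMeasurableSpace E]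
    [DecidableEq E] [Fintype ι] {r : ι → ℝ} {τ : ι → E → E} {κ : ℝ≥0 → Kernel E E}
    (hκ : IsJumpSemigroup r τ κ) {f : E → ℝ} {B : ℝ} (hB : ∀ x, |f x| ≤ B) (s t : ℝ≥0) (x : E) :
    ∫ y, f y ∂κ (s + t) x = ∫ y, ∫ z, f z ∂κ t y ∂κ s x := by
  have := hκ.markov
  rw [hκ.add, Kernel.integral_comp]
  rw [← hκ.add]
  exact integrable_of_abs_le hB

variable {E ι : Type*} [Countable E] [MeasurableSpace E] [DiscreteMeasurableSpace E]
  [DecidableEq E] [Fintype ι] {r : ι → ℝ} {τ : ι → E → E} {κ : ℝ≥0 → Kernel E E}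

/-- The speed of convergence in `tendsto_integral_sub_div` is bounded uniformly in the state, so
the derivative may be taken under the integral. -/
theorem tendsto_integral_integral_sub_div (hκ : IsJumpSemigroup r τ κ) {μ : Measure E}
    [IsProbabilityMeasure μ] {f : E → ℝ} {B : ℝ} (hB : ∀ x, |f x| ≤ B) :
    Tendsto (fun h : ℝ≥0 => ∫ x, (∫ y, f y ∂κ h x - f x) / (h : ℝ) ∂μ) (𝓝[>] 0)
      (𝓝 (∫ x, jumpGenerator r τ f x ∂μ)) := by
  refine tendsto_integral_filter_of_dominated_convergence (fun _ => 2 * B * ∑ i, r i)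
    (Eventually.of_forall fun h => Measurable.of_discrete.aestronglyMeasurable) ?_
    (integrable_const _) (Eventually.of_forall fun x => hκ.tendsto_integral_sub_div hB x)
  filter_upwards [self_mem_nhdsWithin] with h hh
  refine Eventually.of_forall fun x => ?_
  have hpos : (0 : ℝ) < h := hh
  rw [norm_div, Real.norm_of_nonneg hpos.le, div_le_iff₀ hpos]
  exact hκ.abs_integral_sub_le hB h x

theorem integral_jumpGenerator_eq_zero (hκ : IsJumpSemigroup r τ κ) {μ : Measure E}
    [IsProbabilityMeasure μ] (hμ : ∀ t, (κ t).Invariant μ) {f : E → ℝ} {B : ℝ}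
    (hB : ∀ x, |f x| ≤ B) : ∫ x, jumpGenerator r τ f x ∂μ = 0 := by
  have := hκ.markov
  refine tendsto_nhds_unique (hκ.tendsto_integral_integral_sub_div hB) ?_
  refine tendsto_const_nhds.congr fun h => ?_
  have h1 : Integrable (fun x => ∫ y, f y ∂κ h x) μ :=
    integrable_of_abs_le fun x => abs_integral_le_of_abs_le hB
  have h2 : Integrable f μ := integrable_of_abs_le hB
  have h3 : ∫ x, f x ∂μ = ∫ x, ∫ y, f y ∂κ h x ∂μ := by
    conv_lhs => rw [← (hμ h).def]
    exact integral_kernel_bind (integrable_of_abs_le hB)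
  rw [integral_div, integral_sub h1 h2, ← h3]
  simp

/-- If `μ` annihilates the generator, then `t ↦ ∫ P_t f dμ` is Lipschitz with right derivative
`∫ L (P_t f) dμ = 0`, hence constant. -/
theorem invariant_of_integral_jumpGenerator_eq_zero (hκ : IsJumpSemigroup r τ κ) {μ : Measure E}
    [IsProbabilityMeasure μ]
    (hμ : ∀ (f : E → ℝ) (B : ℝ), (∀ x, |f x| ≤ B) → ∫ x, jumpGenerator r τ f x ∂μ = 0)
    (t : ℝ≥0) : (κ t).Invariant μ := by
  have := hκ.markov
  have key : ∀ (f : E → ℝ) (B : ℝ), (∀ x, |f x| ≤ B) →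
      ∫ x, ∫ y, f y ∂κ t x ∂μ = ∫ x, f x ∂μ := by
    intro f B hB
    let S : ℝ≥0 → E → ℝ := fun u x => ∫ y, f y ∂κ u x
    have hS : ∀ u x, |S u x| ≤ B := fun u x => abs_integral_le_of_abs_le hB
    have hSi : ∀ u, Integrable (S u) μ := fun u => integrable_of_abs_le (hS u)
    have hinc : ∀ u h, ∫ x, S (u + h) x ∂μ - ∫ x, S u x ∂μ =
        ∫ x, (∫ y, S u y ∂κ h x - S u x) ∂μ := by
      intro u h
      rw [integral_sub (integrable_of_abs_le fun x => abs_integral_le_of_abs_le (hS u)) (hSi u)]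
      congr 2
      funext x
      change ∫ y, f y ∂κ (u + h) x = _
      rw [add_comm, hκ.integral_add hB]
    let φ : ℝ → ℝ := fun u => ∫ x, S u.toNNReal x ∂μ
    have hφ : ∀ u v : ℝ, 0 ≤ u → u ≤ v → φ v - φ u =
        ∫ x, (∫ y, S u.toNNReal y ∂κ (v - u).toNNReal x - S u.toNNReal x) ∂μ := by
      intro u v hu huv
      rw [← hinc, ← Real.toNNReal_add hu (sub_nonneg.2 huv), add_sub_cancel]
    have hB0 : 0 ≤ 2 * B * ∑ i, r i := by
      obtain ⟨x⟩ := nonempty_of_isProbabilityMeasure μ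
      exact mul_nonneg (mul_nonneg zero_le_two ((abs_nonneg _).trans (hB x)))
        (Finset.sum_nonneg fun i _ => hκ.rate_nonneg i)
    have hlip : LipschitzOnWith (2 * B * ∑ i, r i).toNNReal φ (Set.Icc 0 t) := by
      refine LipschitzOnWith.of_le_add_mul' _ ?_
      have hmono : ∀ u v : ℝ, 0 ≤ u → u ≤ v → |φ v - φ u| ≤ (2 * B * ∑ i, r i) * (v - u) := by
        intro u v hu huv
        rw [hφ u v hu huv]
        have := abs_integral_le_of_abs_le (μ := μ) fun x =>
          hκ.abs_integral_sub_le (hS u.toNNReal) (v - u).toNNReal x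
        rwa [Real.coe_toNNReal _ (sub_nonneg.2 huv)] at this
      intro u hu v hv
      rw [Real.dist_eq]
      rcases le_total u v with h | h
      · have := (abs_le.1 (hmono u v hu.1 h)).1
        rw [abs_sub_comm, abs_of_nonneg (sub_nonneg.2 h)]
        linarith
      · have := (abs_le.1 (hmono v u hv.1 h)).2
        rw [abs_of_nonneg (sub_nonneg.2 h)]
        linarith
    have hderiv : ∀ u ∈ Set.Ico (0 : ℝ) t, HasDerivWithinAt φ 0 (Set.Ici u) u := by
      intro u hu
      rw [← hasDerivWithinAt_Ioi_iff_Ici, hasDerivWithinAt_iff_tendsto_slope'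
        (Set.notMem_Ioi.2 le_rfl)]
      have hlim : Tendsto (fun v : ℝ => (v - u).toNNReal) (𝓝[>] u) (𝓝[>] 0) := by
        refine tendsto_nhdsWithin_iff.2 ⟨?_, ?_⟩
        · have : Tendsto (fun v : ℝ => (v - u).toNNReal) (𝓝 u) (𝓝 (u - u).toNNReal) :=
            (continuous_real_toNNReal.comp (continuous_id.sub continuous_const)).tendsto u
          rw [sub_self, Real.toNNReal_zero] at this
          exact this.mono_left nhdsWithin_le_nhds
        · filter_upwards [self_mem_nhdsWithin] with v hv
          exact Real.toNNReal_pos.2 (sub_pos.2 hv)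
      have h1 := (hκ.tendsto_integral_integral_sub_div (μ := μ) (hS u.toNNReal)).comp hlim
      rw [hμ _ B (hS u.toNNReal)] at h1
      refine h1.congr' ?_
      filter_upwards [self_mem_nhdsWithin] with v hv
      have hv' : u < v := hv
      rw [Function.comp_apply, integral_div, Real.coe_toNNReal _ (sub_nonneg.2 hv'.le),
        ← hφ u v hu.1 hv'.le, slope_def_field]
    have hconst := constant_of_has_deriv_right_zero hlip.continuousOn hderiv t
      ⟨t.coe_nonneg, le_rfl⟩
    simpa [φ, S, hκ.zero, Kernel.id_apply] using hconst
  have hP : IsProbabilityMeasure (μ.bind (κ t)) := inferInstance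
  rw [Kernel.Invariant]
  refine Measure.ext_of_measureReal_singleton fun y => ?_
  have hB : ∀ x, |({y} : Set E).indicator (1 : E → ℝ) x| ≤ 1 := by
    intro x
    by_cases hx : x = y <;> simp [hx]
  have h1 := integral_kernel_bind (μ := μ) (κ := κ t) (integrable_of_abs_le hB)
  rw [key _ 1 hB, integral_indicator_one (MeasurableSet.singleton y),
    integral_indicator_one (MeasurableSet.singleton y)] at h1
  exact h1

theorem apply_self_pos (hκ : IsJumpSemigroup r τ κ) (t : ℝ≥0) (x : E) :
    0 < (κ t x).real {x} := by
  -- Cut `t` into `n` steps so short that the process stays put with positive probability.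
  obtain ⟨n, hn⟩ := exists_nat_gt ((∑ i, r i) * t)
  have hn0 : (0 : ℝ) < n :=
    (mul_nonneg (Finset.sum_nonneg fun i _ => hκ.rate_nonneg i) t.coe_nonneg).trans_lt hn
  have h1 : 0 < (κ (t / n) x).real {x} := by
    have h2 := hκ.one_sub_apply_self_le (t / n) x
    have h3 : (∑ i, r i) * ((t / n : ℝ≥0) : ℝ) < 1 := by
      push_cast
      rw [← mul_div_assoc, div_lt_one hn0]
      exact hn
    linarith
  have h2 : ∀ m : ℕ, 0 < (κ (m * (t / n)) x).real {x} := by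
    intro m
    induction m with
    | zero => simp [hκ.apply_zero_self]
    | succ m ih =>
      push_cast
      rw [add_mul, one_mul]
      exact (mul_pos ih h1).trans_le (hκ.mul_le_apply_add _ _ x x x)
  have h3 : (n : ℝ≥0) * (t / n) = t := by
    have : (n : ℝ≥0) ≠ 0 := by exact_mod_cast hn0.ne'
    field_simp
  simpa [h3] using h2 n

theorem apply_move_pos (hκ : IsJumpSemigroup r τ κ) {i : ι} (hi : 0 < r i) {t : ℝ≥0} (ht : 0 < t)
    (x : E) : 0 < (κ t x).real {τ i x} := by
  rcases eq_or_ne x (τ i x) with hx | hx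
  · rw [← hx]
    exact hκ.apply_self_pos t x
  have hpos : 0 < ∑ j, r j *
      ((if τ j x = τ i x then 1 else 0) - if x = τ i x then 1 else 0) := by
    refine Finset.sum_pos' (fun j _ => mul_nonneg (hκ.rate_nonneg j) ?_)
      ⟨i, Finset.mem_univ i, by simpa [hx] using hi⟩
    rw [if_neg hx]
    split_ifs <;> norm_num
  obtain ⟨h, hh, hht⟩ := (((hκ.generator x (τ i x)).eventually_const_lt hpos).and
    (Ioo_mem_nhdsGT ht)).exists
  simp only [hx, if_false, sub_zero] at hh
  have h1 : 0 < (κ h x).real {τ i x} := by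
    by_contra hc
    exact hh.not_ge (div_nonpos_of_nonpos_of_nonneg (not_lt.1 hc) h.coe_nonneg)
  have h2 := hκ.mul_le_apply_add h (t - h) x (τ i x) (τ i x)
  rw [add_tsub_cancel_of_le hht.2.le] at h2
  exact (mul_pos h1 (hκ.apply_self_pos _ _)).trans_le h2

/-- If `y` can be reached from `x` by moves of positive rate, then `y` has positive probability at
every positive time. -/
theorem apply_pos_of_reflTransGen (hκ : IsJumpSemigroup r τ κ) (hr : ∀ i, 0 < r i) {x y : E}
    (hxy : Relation.ReflTransGen (fun a b => ∃ i, b = τ i a) x y) {t : ℝ≥0} (ht : 0 < t) :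
    0 < (κ t x).real {y} := by
  induction hxy generalizing t with
  | refl => exact hκ.apply_self_pos t x
  | @tail z _ _ h ih =>
    obtain ⟨i, rfl⟩ := h
    have ht2 : 0 < t / 2 := by positivity
    have h1 := hκ.mul_le_apply_add (t / 2) (t / 2) x z (τ i z)
    rw [add_halves] at h1
    exact (mul_pos (ih ht2) (hκ.apply_move_pos (hr i) ht2 _)).trans_le h1

end IsJumpSemigroup

/-! ### Contraction by stochastic matrices and convergence to equilibrium -/

section StochasticMatrix

variable {E : Type*} {K : E → E → ℝ} {v : E → ℝ}

theorem summable_abs_mul_stochastic (hK0 : ∀ x y, 0 ≤ K x y) (hK1 : ∀ x, HasSum (K x) 1)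
    (hv : Summable v) : Summable fun p : E × E => |v p.1| * K p.1 p.2 := by
  have h0 : (0 : E × E → ℝ) ≤ fun p => |v p.1| * K p.1 p.2 :=
    fun p => mul_nonneg (abs_nonneg _) (hK0 _ _)
  refine (summable_prod_of_nonneg h0).2 ⟨fun x => (hK1 x).summable.mul_left |v x|, ?_⟩
  simpa [tsum_mul_left, (hK1 _).tsum_eq] using hv.abs

theorem tsum_tsum_abs_mul_stochastic (hK0 : ∀ x y, 0 ≤ K x y) (hK1 : ∀ x, HasSum (K x) 1)
    (hv : Summable v) : ∑' y, ∑' x, |v x| * K x y = ∑' x, |v x| := by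
  have h := summable_abs_mul_stochastic hK0 hK1 hv
  rw [Summable.tsum_comm (f := fun x y => |v x| * K x y) h]
  simp [tsum_mul_left, (hK1 _).tsum_eq]

theorem summable_column_abs (hK0 : ∀ x y, 0 ≤ K x y) (hK1 : ∀ x, HasSum (K x) 1)
    (hv : Summable v) (y : E) : Summable fun x => |v x| * K x y :=
  (summable_abs_mul_stochastic hK0 hK1 hv).prod_symm.prod_factor y

theorem summable_column (hK0 : ∀ x y, 0 ≤ K x y) (hK1 : ∀ x, HasSum (K x) 1)
    (hv : Summable v) (y : E) : Summable fun x => v x * K x y := by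
  refine Summable.of_norm ?_
  simpa [abs_mul, abs_of_nonneg (hK0 _ _)] using summable_column_abs hK0 hK1 hv y

theorem abs_tsum_column_le (hK0 : ∀ x y, 0 ≤ K x y) (hK1 : ∀ x, HasSum (K x) 1)
    (hv : Summable v) (y : E) : |∑' x, v x * K x y| ≤ ∑' x, |v x| * K x y := by
  have h := summable_column_abs hK0 hK1 hv y
  refine (norm_tsum_le_tsum_norm (f := fun x => v x * K x y) ?_).trans (le_of_eq ?_) <;>
    simp only [Real.norm_eq_abs, abs_mul, abs_of_nonneg (hK0 _ _), h]

theorem summable_abs_tsum_column (hK0 : ∀ x y, 0 ≤ K x y) (hK1 : ∀ x, HasSum (K x) 1)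
    (hv : Summable v) : Summable fun y => |∑' x, v x * K x y| :=
  Summable.of_nonneg_of_le (fun _ => abs_nonneg _) (abs_tsum_column_le hK0 hK1 hv)
    (summable_abs_mul_stochastic hK0 hK1 hv).prod_symm.prod

theorem tsum_abs_tsum_column_le (hK0 : ∀ x y, 0 ≤ K x y) (hK1 : ∀ x, HasSum (K x) 1)
    (hv : Summable v) : ∑' y, |∑' x, v x * K x y| ≤ ∑' x, |v x| := by
  rw [← tsum_tsum_abs_mul_stochastic hK0 hK1 hv]
  exact Summable.tsum_le_tsum (abs_tsum_column_le hK0 hK1 hv)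
    (summable_abs_tsum_column hK0 hK1 hv)
    (summable_abs_mul_stochastic hK0 hK1 hv).prod_symm.prod

/-- A strictly positive stochastic matrix strictly contracts the `ℓ¹`-norm of every signed measure
that takes both signs. -/
theorem tsum_abs_tsum_column_lt (hK0 : ∀ x y, 0 < K x y) (hK1 : ∀ x, HasSum (K x) 1)
    (hv : Summable v) {x₁ x₂ : E} (h₁ : 0 < v x₁) (h₂ : v x₂ < 0) :
    ∑' y, |∑' x, v x * K x y| < ∑' x, |v x| := by
  have hK0' : ∀ x y, 0 ≤ K x y := fun x y => (hK0 x y).le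
  rw [← tsum_tsum_abs_mul_stochastic hK0' hK1 hv]
  refine Summable.tsum_lt_tsum (abs_tsum_column_le hK0' hK1 hv) (i := x₁) ?_
    (summable_abs_tsum_column hK0' hK1 hv)
    (summable_abs_mul_stochastic hK0' hK1 hv).prod_symm.prod
  have hs := summable_column hK0' hK1 hv x₁
  have ha := summable_column_abs hK0' hK1 hv x₁
  rw [abs_lt]
  constructor
  · rw [← tsum_neg]
    refine Summable.tsum_lt_tsum (i := x₁) (fun x => ?_) ?_ ha.neg hs
    · nlinarith [hK0 x x₁, neg_abs_le (v x)]
    · nlinarith [hK0 x₁ x₁, abs_nonneg (v x₁)]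
  · refine Summable.tsum_lt_tsum (i := x₂) (fun x => ?_) ?_ hs ha
    · exact mul_le_mul_of_nonneg_right (le_abs_self _) (hK0' _ _)
    · nlinarith [hK0 x₂ x₁, abs_nonneg (v x₂)]

/-- A sequence in `ℝ^E` dominated by a fixed function has a pointwise convergent subsequence when
`E` is countable. -/
theorem exists_subseq_tendsto_of_abs_le [Countable E] {D : E → ℝ} {a : ℕ → E → ℝ}
    (ha : ∀ n y, |a n y| ≤ D y) :
    ∃ w : E → ℝ, ∃ φ : ℕ → ℕ, StrictMono φ ∧ ∀ y, Tendsto (fun n => a (φ n) y) atTop (𝓝 (w y)) := by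
  have hc : IsCompact (Set.univ.pi fun y => Set.Icc (-D y) (D y)) :=
    isCompact_univ_pi fun y => isCompact_Icc
  obtain ⟨w, -, φ, hφ, hw⟩ := hc.tendsto_subseq (x := a)
    fun n y _ => abs_le.1 (ha n y)
  exact ⟨w, φ, hφ, fun y => (tendsto_pi_nhds.1 hw) y⟩

end StochasticMatrix

theorem real_kernel_bind_singleton {E : Type*} [Countable E] [MeasurableSpace E]
    [DiscreteMeasurableSpace E] {κ : Kernel E E} [IsMarkovKernel κ] {μ : Measure E}
    [IsProbabilityMeasure μ] (z : E) :
    (μ.bind κ).real {z} = ∑' y, μ.real {y} * (κ y).real {z} := by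
  have hB : ∀ x, |({z} : Set E).indicator (1 : E → ℝ) x| ≤ 1 := by
    intro x
    by_cases hx : x = z <;> simp [hx]
  have h := integral_kernel_bind (μ := μ) (κ := κ) (integrable_of_abs_le hB)
  simp_rw [integral_indicator_one (MeasurableSet.singleton z)] at h
  rw [h, integral_countable]
  · rfl
  · exact integrable_of_abs_le (B := 1) fun x => by
      rw [abs_of_nonneg measureReal_nonneg]
      exact measureReal_le_one

theorem hasSum_real_singleton {E : Type*} [Countable E] [MeasurableSpace E]
    [DiscreteMeasurableSpace E] (μ : Measure E) [IsProbabilityMeasure μ] :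
    HasSum (fun y => μ.real {y}) 1 := by
  have h := hasSum_integral_iUnion (μ := μ) (f := fun _ : E => (1 : ℝ)) (s := fun y : E => {y})
    (fun y => MeasurableSet.singleton y) (fun a b hab => by simpa using hab)
    (integrable_const _).integrableOn
  rw [Set.iUnion_of_singleton] at h
  simpa [measureReal_def] using h

theorem real_singleton_pos_of_invariant {E : Type*} [Countable E] [MeasurableSpace E]
    [DiscreteMeasurableSpace E] {κ : Kernel E E} [IsMarkovKernel κ]
    (hpos : ∀ x y, 0 < (κ x).real {y}) {μ : Measure E} [IsProbabilityMeasure μ]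
    (hμ : κ.Invariant μ) (z : E) : 0 < μ.real {z} := by
  have hm1 := hasSum_real_singleton μ
  rw [← hμ.def, real_kernel_bind_singleton z]
  have hex : ∃ a, μ.real {a} ≠ 0 := by
    by_contra! h
    simp only [h] at hm1
    exact zero_ne_one (hasSum_zero.unique hm1)
  obtain ⟨a, ha⟩ := hex
  exact Summable.tsum_pos (summable_column (fun _ _ => measureReal_nonneg)
    (fun x => hasSum_real_singleton (κ x)) hm1.summable z)
    (fun b => mul_nonneg measureReal_nonneg measureReal_nonneg) a
    (mul_pos (lt_of_le_of_ne measureReal_nonneg ha.symm) (hpos a z))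

namespace IsJumpSemigroup

variable {E ι : Type*} [Countable E] [MeasurableSpace E] [DiscreteMeasurableSpace E]
  [DecidableEq E] [Fintype ι] {r : ι → ℝ} {τ : ι → E → E} {κ : ℝ≥0 → Kernel E E}

/-- Convergence to equilibrium. The law at time `t` started from `x` is dominated by
`μ / μ {x}`, so along integer times its difference from `μ` has limit points in `ℓ¹`; at such a
limit point the `ℓ¹`-norm cannot be decreased by the strictly positive kernel `κ 1`, so the limit
point is `0`. -/
theorem tendsto_apply (hκ : IsJumpSemigroup r τ κ)
    (hpos : ∀ t, 0 < t → ∀ x y, 0 < (κ t x).real {y}) {μ : Measure E} [IsProbabilityMeasure μ]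
    (hμ : ∀ t, (κ t).Invariant μ) (x y : E) :
    Tendsto (fun t => (κ t x).real {y}) atTop (𝓝 (μ.real {y})) := by
  have := hκ.markov
  let K : ℝ≥0 → E → E → ℝ := fun t a b => (κ t a).real {b}
  have hK0 : ∀ t a b, 0 ≤ K t a b := fun _ _ _ => measureReal_nonneg
  have hK1 : ∀ t a, HasSum (K t a) 1 := fun t a => hasSum_real_singleton _
  have hm1 := hasSum_real_singleton μ
  have hm : ∀ t z, μ.real {z} = ∑' a, μ.real {a} * K t a z := fun t z => by
    conv_lhs => rw [← (hμ t).def]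
    exact real_kernel_bind_singleton z
  have hCK : ∀ s t z, K (s + t) x z = ∑' a, K s x a * K t a z := fun s t z => by
    change (κ (s + t) x).real {z} = _
    rw [hκ.add, Kernel.comp_apply]
    exact real_kernel_bind_singleton z
  let v : ℝ≥0 → E → ℝ := fun t z => K t x z - μ.real {z}
  have hvs : ∀ t, Summable (v t) := fun t => (hK1 t x).summable.sub hm1.summable
  have hv : ∀ s t z, v (s + t) z = ∑' a, v s a * K t a z := fun s t z => by
    change K (s + t) x z - μ.real {z} = _
    rw [hCK, hm t z, ← Summable.tsum_sub (summable_column (hK0 t) (hK1 t) (hK1 s x).summable z)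
      (summable_column (hK0 t) (hK1 t) hm1.summable z)]
    simp only [v, sub_mul]
  let d : ℝ≥0 → ℝ := fun t => ∑' z, |v t z|
  have hd : Antitone d := fun s t hst => by
    obtain ⟨u, rfl⟩ := exists_add_of_le hst
    simp only [d, hv]
    exact tsum_abs_tsum_column_le (hK0 u) (hK1 u) (hvs s)
  have hmx : ∀ z, 0 < μ.real {z} :=
    real_singleton_pos_of_invariant (hpos 1 one_pos) (hμ 1)
  have hdom : ∀ t z, K t x z ≤ μ.real {z} / μ.real {x} := by
    intro t z
    rw [le_div_iff₀ (hmx x), hm t z, mul_comm]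
    exact (summable_column (hK0 t) (hK1 t) hm1.summable z).le_tsum x
      fun b _ => mul_nonneg measureReal_nonneg (hK0 _ _ _)
  let D : E → ℝ := fun z => μ.real {z} / μ.real {x} + μ.real {z}
  have hDs : Summable D := (hm1.summable.div_const _).add hm1.summable
  have hvD : ∀ t z, |v t z| ≤ D z := fun t z => by
    refine (abs_sub _ _).trans ?_
    rw [abs_of_nonneg (hK0 t x z), abs_of_nonneg measureReal_nonneg]
    exact add_le_add (hdom t z) le_rfl
  obtain ⟨w, φ, hφ, hw⟩ := exists_subseq_tendsto_of_abs_le (a := fun n : ℕ => v n)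
    fun n => hvD n
  have hwD : ∀ z, |w z| ≤ D z := fun z =>
    le_of_tendsto' (hw z).abs fun n => hvD _ z
  have hws : Summable w := Summable.of_norm_bounded hDs hwD
  have hdφ : Tendsto (fun n => d (φ n : ℕ)) atTop (𝓝 (∑' z, |w z|)) :=
    tendsto_tsum_of_dominated_convergence hDs (fun z => (hw z).abs)
      (Eventually.of_forall fun n z => by simpa using hvD _ z)
  have hdφ1 : Tendsto (fun n => d ((φ n : ℕ) + 1)) atTop (𝓝 (∑' z, |∑' a, w a * K 1 a z|)) := by
    refine tendsto_tsum_of_dominated_convergence hDs (fun z => ?_)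
      (Eventually.of_forall fun n z => by simpa using hvD _ z)
    simp only [hv]
    refine (tendsto_tsum_of_dominated_convergence hDs (fun a => (hw a).mul_const _)
      (Eventually.of_forall fun n a => ?_)).abs
    rw [norm_mul, Real.norm_of_nonneg (hK0 1 a z)]
    exact (mul_le_of_le_one_right (norm_nonneg _) measureReal_le_one).trans (hvD _ a)
  have hbdd : BddBelow (Set.range fun n : ℕ => d n) :=
    ⟨0, by rintro _ ⟨n, rfl⟩; exact tsum_nonneg fun z => abs_nonneg _⟩
  have hdn : Tendsto (fun n : ℕ => d n) atTop (𝓝 (⨅ n : ℕ, d n)) :=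
    tendsto_atTop_ciInf (fun a b hab => hd (by exact_mod_cast hab)) hbdd
  -- The distance `d` is antitone, so `w` and its image under `κ 1` have the same norm.
  have hL : ⨅ n : ℕ, d n = ∑' z, |w z| :=
    tendsto_nhds_unique (hdn.comp hφ.tendsto_atTop) hdφ
  have hL1 : ⨅ n : ℕ, d n = ∑' z, |∑' a, w a * K 1 a z| := by
    refine tendsto_nhds_unique
      ((hdn.comp (tendsto_add_atTop_nat 1)).comp hφ.tendsto_atTop) (hdφ1.congr fun n => ?_)
    simp
  have hw0 : ∑' z, w z = 0 := by
    have h1 : Tendsto (fun n => ∑' z, v (φ n : ℕ) z) atTop (𝓝 (∑' z, w z)) :=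
      tendsto_tsum_of_dominated_convergence hDs hw (Eventually.of_forall fun n z => hvD _ z)
    refine tendsto_nhds_unique h1 (tendsto_const_nhds.congr fun n => ?_)
    rw [Summable.tsum_sub (hK1 _ x).summable hm1.summable, (hK1 _ x).tsum_eq, hm1.tsum_eq, sub_self]
  have hwz : ∀ z, w z = 0 := by
    by_contra! hne
    obtain ⟨z, hz⟩ := hne
    have hp : ∃ a, 0 < w a := by
      by_contra! h
      have h1 := (hasSum_zero_iff_of_nonneg (f := fun a => -w a)
        fun a => neg_nonneg.2 (h a)).1 (by simpa [tsum_neg, hw0] using hws.neg.hasSum)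
      exact hz (by simpa using congrFun h1 z)
    have hn : ∃ a, w a < 0 := by
      by_contra! h
      have h1 := (hasSum_zero_iff_of_nonneg h).1 (by simpa [hw0] using hws.hasSum)
      exact hz (by simpa using congrFun h1 z)
    obtain ⟨a, ha⟩ := hp
    obtain ⟨c, hc⟩ := hn
    have := tsum_abs_tsum_column_lt (hpos 1 one_pos) (hK1 1) hws ha hc
    exact this.ne (hL1.symm.trans hL)
  have hL0 : ⨅ n : ℕ, d n = 0 := by rw [hL]; simp [hwz]
  rw [hL0] at hdn
  have hdt : Tendsto d atTop (𝓝 0) := by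
    refine squeeze_zero (fun t => tsum_nonneg fun z => abs_nonneg _)
      (fun t => hd (Nat.floor_le zero_le)) (hdn.comp tendsto_nat_floor_atTop)
  rw [tendsto_iff_norm_sub_tendsto_zero]
  refine squeeze_zero (fun _ => norm_nonneg _) (fun t => ?_) hdt
  exact (hvs t).abs.le_tsum y fun z _ => abs_nonneg _

end IsJumpSemigroup

/-! ### Existence of an equilibrium by uniformisation -/

/-- The kernel of the uniformised chain: move `i` is chosen with probability `r i / ∑ j, r j`. -/
noncomputable def uniformizedKernel {E ι : Type*} [Countable E] [MeasurableSpace E]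
    [DiscreteMeasurableSpace E] [Fintype ι] (r : ι → ℝ) (τ : ι → E → E) : Kernel E E :=
  Kernel.ofFunOfCountable fun x => ∑ i, ENNReal.ofReal (r i / ∑ j, r j) • Measure.dirac (τ i x)

section Uniformization

variable {E ι : Type*} [Countable E] [MeasurableSpace E] [DiscreteMeasurableSpace E]
  [Fintype ι] {r : ι → ℝ} {τ : ι → E → E}

theorem uniformizedKernel_apply (x : E) : uniformizedKernel r τ x =
    ∑ i, ENNReal.ofReal (r i / ∑ j, r j) • Measure.dirac (τ i x) := rfl

theorem isMarkovKernel_uniformizedKernel (hr : ∀ i, 0 ≤ r i) (hR : 0 < ∑ i, r i) :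
    IsMarkovKernel (uniformizedKernel r τ) := by
  refine ⟨fun x => ⟨?_⟩⟩
  rw [uniformizedKernel_apply, Measure.finsetSum_apply]
  simp only [Measure.smul_apply, measure_univ, smul_eq_mul, mul_one]
  rw [← ENNReal.ofReal_sum_of_nonneg fun i _ => div_nonneg (hr i) hR.le, ← Finset.sum_div,
    div_self hR.ne', ENNReal.ofReal_one]

theorem integral_uniformizedKernel (hr : ∀ i, 0 ≤ r i) (hR : 0 < ∑ i, r i) {f : E → ℝ} {B : ℝ}
    (hB : ∀ x, |f x| ≤ B) (x : E) :
    ∫ y, f y ∂uniformizedKernel r τ x = f x + jumpGenerator r τ f x / ∑ i, r i := by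
  have hi : ∀ i ∈ Finset.univ,
      Integrable f (ENNReal.ofReal (r i / ∑ j, r j) • Measure.dirac (τ i x)) := fun i _ =>
    (integrable_of_abs_le hB).smul_measure ENNReal.ofReal_ne_top
  rw [uniformizedKernel_apply, integral_finsetSum_measure hi]
  simp only [integral_smul_measure, integral_dirac, smul_eq_mul,
    ENNReal.toReal_ofReal (div_nonneg (hr _) hR.le)]
  have h1 : f x = ∑ i, r i / (∑ j, r j) * f x := by
    rw [← Finset.sum_mul, ← Finset.sum_div, div_self hR.ne', one_mul]
  rw [jumpGenerator, Finset.sum_div]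
  conv_rhs => enter [1]; rw [h1]
  rw [← Finset.sum_add_distrib]
  exact Finset.sum_congr rfl fun i _ => by ring

theorem integral_bind_uniformizedKernel (hr : ∀ i, 0 ≤ r i) (hR : 0 < ∑ i, r i) {f : E → ℝ}
    {B : ℝ} (hB : ∀ x, |f x| ≤ B) (μ : Measure E) [IsProbabilityMeasure μ] :
    ∫ x, f x ∂μ.bind (uniformizedKernel r τ) =
      ∫ x, f x ∂μ + (∫ x, jumpGenerator r τ f x ∂μ) / ∑ i, r i := by
  have := isMarkovKernel_uniformizedKernel (τ := τ) hr hR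
  have hL : Integrable (jumpGenerator r τ f) μ := integrable_of_abs_le (abs_jumpGenerator_le hr hB)
  rw [integral_kernel_bind (integrable_of_abs_le hB)]
  simp_rw [integral_uniformizedKernel hr hR hB]
  rw [MeasureTheory.integral_add (integrable_of_abs_le hB) (hL.div_const _), integral_div]

end Uniformization

/-- A nonnegative function on a countable space with sum one is the density of a probability
measure. -/
theorem exists_measure_real_singleton {E : Type*} [MeasurableSpace E]
    [DiscreteMeasurableSpace E] {w : E → ℝ} (hw0 : ∀ x, 0 ≤ w x) (hw1 : HasSum w 1) :
    ∃ μ : Measure E, IsProbabilityMeasure μ ∧ ∀ x, μ.real {x} = w x := by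
  have h : HasSum (fun x => ENNReal.ofReal (w x)) 1 := by
    rw [← ENNReal.ofReal_one, ← hw1.tsum_eq, ENNReal.ofReal_tsum_of_nonneg hw0 hw1.summable]
    exact ENNReal.summable.hasSum
  let p : PMF E := ⟨fun x => ENNReal.ofReal (w x), h⟩
  refine ⟨p.toMeasure, inferInstance, fun x => ?_⟩
  rw [measureReal_def, p.toMeasure_apply_singleton x (MeasurableSet.singleton x)]
  exact ENNReal.toReal_ofReal (hw0 x)

/-- Krylov–Bogoliubov along a factor. If the process with moves `τ` projects under `proj` onto the
process with moves `σ`, for which `m` is an equilibrium, then every law whose projection is `m`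
keeps this property under the uniformised chain. All these laws are dominated by `m ∘ proj`; when
this is summable, no mass can escape, and a limit point of the time averages is an equilibrium of
the process with moves `τ`. -/
theorem exists_integral_jumpGenerator_eq_zero {E F ι : Type*} [Countable E] [MeasurableSpace E]
    [DiscreteMeasurableSpace E] [Countable F] [MeasurableSpace F] [DiscreteMeasurableSpace F]
    [Fintype ι] {r : ι → ℝ} (hr : ∀ i, 0 ≤ r i) (hR : 0 < ∑ i, r i) {τ : ι → E → E}
    {σ : ι → F → F} {proj : E → F} {sec : F → E} (hsec : ∀ q, proj (sec q) = q)
    (hproj : ∀ i x, proj (τ i x) = σ i (proj x)) {m : Measure F} [IsProbabilityMeasure m]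
    (hm : ∀ (g : F → ℝ) (B : ℝ), (∀ q, |g q| ≤ B) → ∫ q, jumpGenerator r σ g q ∂m = 0)
    (hD : Summable fun x => m.real {proj x}) :
    ∃ μ : Measure E, IsProbabilityMeasure μ ∧
      ∀ (f : E → ℝ) (B : ℝ), (∀ x, |f x| ≤ B) → ∫ x, jumpGenerator r τ f x ∂μ = 0 := by
  have hU := isMarkovKernel_uniformizedKernel (τ := τ) hr hR
  obtain ⟨ν, hν0, hνs⟩ : ∃ ν : ℕ → Measure E, ν 0 = m.map sec ∧
      ∀ n, ν (n + 1) = (ν n).bind (uniformizedKernel r τ) :=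
    ⟨Nat.rec (m.map sec) fun _ μ => μ.bind (uniformizedKernel r τ), rfl, fun _ => rfl⟩
  have hν : ∀ n, IsProbabilityMeasure (ν n) := by
    intro n
    induction n with
    | zero =>
      rw [hν0]
      exact Measure.isProbabilityMeasure_map (Measurable.of_discrete).aemeasurable
    | succ n ih => rw [hνs]; infer_instance
  have hνm : ∀ n, ∀ (g : F → ℝ) (B : ℝ), (∀ q, |g q| ≤ B) →
      ∫ x, g (proj x) ∂ν n = ∫ q, g q ∂m := by
    intro n
    induction n with
    | zero =>
      intro g B _
      rw [hν0, integral_map (Measurable.of_discrete).aemeasurable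
        (Measurable.of_discrete).aestronglyMeasurable]
      simp only [hsec]
    | succ n ih =>
      intro g B hB
      rw [hνs, integral_bind_uniformizedKernel hr hR (fun x => hB (proj x)), ih g B hB]
      have h1 : ∀ x, jumpGenerator r τ (fun x => g (proj x)) x =
          jumpGenerator r σ g (proj x) := fun x => by simp [jumpGenerator, hproj]
      simp only [h1]
      rw [ih _ _ (abs_jumpGenerator_le hr hB), hm g B hB, zero_div, add_zero]
  have hνD : ∀ n x, (ν n).real {x} ≤ m.real {proj x} := by
    intro n x
    have hB : ∀ q, |({proj x} : Set F).indicator (1 : F → ℝ) q| ≤ 1 := by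
      intro q
      by_cases hq : q = proj x <;> simp [hq]
    have h1 := hνm n _ 1 hB
    rw [integral_indicator_one (MeasurableSet.singleton _)] at h1
    rw [← h1, ← integral_indicator_one (MeasurableSet.singleton x)]
    have hB' : ∀ y, |({x} : Set E).indicator (1 : E → ℝ) y| ≤ 1 := by
      intro y
      by_cases hy : y = x <;> simp [hy]
    refine integral_mono (integrable_of_abs_le hB')
      (integrable_of_abs_le fun y => hB (proj y)) fun y => ?_
    by_cases hy : y = x
    · simp [hy]
    · rw [Set.indicator_of_notMem (Set.mem_singleton_iff.not.2 hy)]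
      exact Set.indicator_nonneg (fun _ _ => zero_le_one) _
  -- The densities of the time averages.
  let a : ℕ → E → ℝ := fun n x => (∑ k ∈ Finset.range (n + 1), (ν k).real {x}) / (n + 1 : ℝ)
  have ha0 : ∀ n x, 0 ≤ a n x := fun n x =>
    div_nonneg (Finset.sum_nonneg fun _ _ => measureReal_nonneg) (by positivity)
  have haD : ∀ n x, |a n x| ≤ m.real {proj x} := by
    intro n x
    rw [abs_of_nonneg (ha0 n x), div_le_iff₀ (by positivity)]
    refine (Finset.sum_le_sum fun k _ => hνD k x).trans (le_of_eq ?_)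
    simp [mul_comm]
  have hai : ∀ n (f : E → ℝ) (B : ℝ), (∀ x, |f x| ≤ B) →
      ∑' x, a n x * f x = (∑ k ∈ Finset.range (n + 1), ∫ x, f x ∂ν k) / (n + 1 : ℝ) := by
    intro n f B hB
    have h1 : ∀ k, HasSum (fun x => (ν k).real {x} * f x) (∫ x, f x ∂ν k) := by
      intro k
      have hi : Integrable f (ν k) := integrable_of_abs_le hB
      rw [integral_countable hi]
      refine (Summable.of_norm_bounded ((hasSum_real_singleton (ν k)).summable.mul_right B)
        fun x => ?_).hasSum
      rw [norm_mul, Real.norm_of_nonneg measureReal_nonneg]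
      exact mul_le_mul_of_nonneg_left (hB x) measureReal_nonneg
    have h2 := (hasSum_sum fun k (_ : k ∈ Finset.range (n + 1)) => h1 k).div_const (n + 1 : ℝ)
    rw [← h2.tsum_eq]
    refine tsum_congr fun x => ?_
    rw [← Finset.sum_mul]
    simp only [a]
    ring
  obtain ⟨w, φ, hφ, hw⟩ := exists_subseq_tendsto_of_abs_le haD
  have hw0 : ∀ x, 0 ≤ w x := fun x => ge_of_tendsto' (hw x) fun n => ha0 _ x
  have hwD : ∀ x, |w x| ≤ m.real {proj x} := fun x =>
    le_of_tendsto' (hw x).abs fun n => haD _ x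
  have hws : Summable w := Summable.of_norm_bounded hD hwD
  have hlim : ∀ (f : E → ℝ) (B : ℝ), (∀ x, |f x| ≤ B) →
      Tendsto (fun n => ∑' x, a (φ n) x * f x) atTop (𝓝 (∑' x, w x * f x)) := by
    intro f B hB
    refine tendsto_tsum_of_dominated_convergence (hD.mul_right B)
      (fun x => (hw x).mul_const _) (Eventually.of_forall fun n x => ?_)
    rw [norm_mul]
    exact mul_le_mul (haD _ x) (hB x) (norm_nonneg _) measureReal_nonneg
  have hw1 : HasSum w 1 := by
    have h1 := hlim (fun _ => 1) 1 (by simp)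
    have h2 : ∑' x, w x = 1 := by
      simp only [mul_one] at h1
      refine tendsto_nhds_unique h1 (tendsto_const_nhds.congr fun n => ?_)
      have h3 := hai (φ n) (fun _ => 1) 1 (by simp)
      simp only [mul_one] at h3
      rw [h3]
      have : (φ n : ℝ) + 1 ≠ 0 := by positivity
      simp [this]
    exact h2 ▸ hws.hasSum
  obtain ⟨μ, hμ, hμw⟩ := exists_measure_real_singleton hw0 hw1
  refine ⟨μ, hμ, fun f B hB => ?_⟩
  have hLB := abs_jumpGenerator_le (r := r) (τ := τ) hr hB
  rw [integral_countable (integrable_of_abs_le hLB)]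
  simp only [hμw, smul_eq_mul]
  refine tendsto_nhds_unique (hlim _ _ hLB) ?_
  -- The integrals of the generator telescope along the uniformised chain.
  have htel : ∀ n, ∑' x, a n x * jumpGenerator r τ f x =
      (∑ i, r i) * (∫ x, f x ∂ν (n + 1) - ∫ x, f x ∂ν 0) / (n + 1 : ℝ) := by
    intro n
    rw [hai n _ _ hLB, ← Finset.sum_range_sub (fun k => ∫ x, f x ∂ν k), Finset.mul_sum]
    congr 1
    refine Finset.sum_congr rfl fun k _ => ?_
    rw [hνs, integral_bind_uniformizedKernel hr hR hB]
    field_simp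
    ring
  have hzero : Tendsto (fun n : ℕ => (∑ i, r i) * (2 * B) / ((n : ℝ) + 1)) atTop (𝓝 0) := by
    simpa [Function.comp_def] using
      (tendsto_const_div_atTop_nhds_zero_nat ((∑ i, r i) * (2 * B))).comp (tendsto_add_atTop_nat 1)
  refine squeeze_zero_norm (fun n => ?_) (hzero.comp hφ.tendsto_atTop)
  rw [htel, Function.comp_apply, norm_div, norm_mul, Real.norm_of_nonneg hR.le,
    Real.norm_of_nonneg (by positivity : (0 : ℝ) ≤ (φ n : ℝ) + 1)]
  refine div_le_div_of_nonneg_right (mul_le_mul_of_nonneg_left ?_ hR.le) (by positivity)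
  refine (norm_sub_le _ _).trans ?_
  have h1 : |∫ x, f x ∂ν (φ n + 1)| ≤ B := abs_integral_le_of_abs_le hB
  have h2 : |∫ x, f x ∂ν 0| ≤ B := abs_integral_le_of_abs_le hB
  rw [Real.norm_eq_abs, Real.norm_eq_abs]
  linarith

/-! ### The transition semigroup of a Markov jump process -/

/-- The transition kernel at time `t` of a Markov family. -/
noncomputable def transitionKernel {E Ω : Type*} [Countable E] [MeasurableSpace E]
    [DiscreteMeasurableSpace E] [MeasurableSpace Ω] (P : E → Measure Ω) (Z : ℝ≥0 → Ω → E)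
    (t : ℝ≥0) : Kernel E E :=
  Kernel.ofFunOfCountable fun x => (P x).map (Z t)

section MarkovFamily

variable {E Ω : Type*} [Countable E] [TopologicalSpace E] [DiscreteTopology E]
  [MeasurableSpace E] [DiscreteMeasurableSpace E] [DecidableEq E] [MeasurableSpace Ω]
  {Q : E → E → ℝ} {P : E → Measure Ω} {Z : ℝ≥0 → Ω → E}

theorem transitionKernel_singleton (hZ : IsMarkovJumpProcess Q P Z) (t : ℝ≥0) (x y : E) :
    transitionKernel P Z t x {y} = P x {ω | Z t ω = y} :=
  Measure.map_apply (hZ.measurable t) (MeasurableSet.singleton y)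

/-- The transition kernels of a Markov family form a jump semigroup; Chapman–Kolmogorov is the
Markov property summed over the intermediate state. -/
theorem isJumpSemigroup_transitionKernel (hZ : IsMarkovJumpProcess Q P Z) {ι : Type*} [Fintype ι]
    {r : ι → ℝ} {τ : ι → E → E} (hr : ∀ i, 0 ≤ r i)
    (hQ : ∀ x y, Q x y = ∑ i, r i * ((if τ i x = y then 1 else 0) - if x = y then 1 else 0)) :
    IsJumpSemigroup r τ (transitionKernel P Z) where
  markov t := ⟨fun x => by
    have := hZ.isProbabilityMeasure x
    exact Measure.isProbabilityMeasure_map (hZ.measurable t).aemeasurable⟩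
  rate_nonneg := hr
  zero := by
    ext1 x
    have := hZ.isProbabilityMeasure x
    rw [Kernel.id_apply]
    refine Measure.ext_of_singleton fun y => ?_
    rw [transitionKernel_singleton hZ, Measure.dirac_apply' _ (MeasurableSet.singleton y)]
    rcases eq_or_ne x y with rfl | hxy
    · simpa using hZ.initial x
    · rw [Set.indicator_of_notMem (by simpa using hxy)]
      have h1 := (prob_compl_eq_zero_iff (μ := P x)
        (hZ.measurable 0 (MeasurableSet.singleton x))).2 (hZ.initial x)
      refine measure_mono_null (fun ω hω => ?_) h1
      have hω' : Z 0 ω = y := hω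
      simpa [hω'] using hxy.symm
  add s t := by
    ext1 x
    refine Measure.ext_of_singleton fun z => ?_
    rw [Kernel.comp_apply' _ _ _ (MeasurableSet.singleton z), lintegral_countable',
      transitionKernel_singleton hZ]
    have h1 : ∀ y, transitionKernel P Z t y {z} * transitionKernel P Z s x {y} =
        P x ({ω | Z s ω = y} ∩ {ω | Z (s + t) ω = z}) := by
      intro y
      have h2 := hZ.markov x s t Set.univ MeasurableSet.univ y z
      rw [Set.univ_inter] at h2
      rw [transitionKernel_singleton hZ, transitionKernel_singleton hZ, h2, mul_comm]
    simp_rw [h1]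
    rw [← measure_iUnion]
    · congr 1
      ext ω
      simp
    · intro a c hac
      refine Set.disjoint_left.2 fun ω h2 h3 => hac ?_
      exact h2.1.symm.trans h3.1
    · intro y
      exact (hZ.measurable s (MeasurableSet.singleton y)).inter
        (hZ.measurable (s + t) (MeasurableSet.singleton z))
  generator x y := by
    have h := hZ.generator x y
    rw [hQ] at h
    simpa only [measureReal_def, transitionKernel_singleton hZ] using h

end MarkovFamily

/-! ### The moves of the queueing-inventory process -/

section Moves

variable {b : ℕ}

/-- Inventory after a service, with `0` sent to itself. -/
def stockDown (k : Fin (b + 1)) : Fin (b + 1) := ⟨k - 1, by omega⟩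

/-- Inventory after a replenishment, with the base stock level `b` sent to itself. -/
def stockUp (k : Fin (b + 1)) : Fin (b + 1) := ⟨min (k + 1) b, by omega⟩

theorem stockDown_succ (j : Fin b) : stockDown j.succ = j.castSucc := by
  ext
  simp [stockDown]

theorem stockUp_castSucc (j : Fin b) : stockUp j.castSucc = j.succ := by
  ext
  simp [stockUp]

theorem stockUp_last : stockUp (Fin.last b) = Fin.last b := by
  ext
  simp [stockUp]

/-- The moves of the queueing-inventory process when ordinary customers are admitted at every
positive inventory: arrival of a priority customer, arrival of an ordinary customer, service and
replenishment. A move that is blocked leaves the state unchanged. -/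
def qiMove (b : ℕ) (i : Fin 4) (z : QIState b) : QIState b :=
  ![(if 0 < (z.2.2 : ℕ) then z.1 + 1 else z.1, z.2.1, z.2.2),
    (z.1, if 0 < (z.2.2 : ℕ) then z.2.1 + 1 else z.2.1, z.2.2),
    if 0 < (z.2.2 : ℕ) ∧ 0 < z.1 + z.2.1 then
      (z.1 - 1, if z.1 = 0 then z.2.1 - 1 else z.2.1, stockDown z.2.2) else z,
    (z.1, z.2.1, stockUp z.2.2)] i

/-- The moves of the pair (total number of customers, inventory), onto which the
queueing-inventory process projects. -/
def totalMove (b : ℕ) (i : Fin 4) (q : ℕ × Fin (b + 1)) : ℕ × Fin (b + 1) :=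
  ![(if 0 < (q.2 : ℕ) then q.1 + 1 else q.1, q.2),
    (if 0 < (q.2 : ℕ) then q.1 + 1 else q.1, q.2),
    if 0 < (q.2 : ℕ) ∧ 0 < q.1 then (q.1 - 1, stockDown q.2) else q,
    (q.1, stockUp q.2)] i

/-- Total number of customers, and inventory. -/
def qiTotal (b : ℕ) (z : QIState b) : ℕ × Fin (b + 1) := (z.1 + z.2.1, z.2.2)

theorem qiTotal_qiMove (i : Fin 4) (z : QIState b) :
    qiTotal b (qiMove b i z) = totalMove b i (qiTotal b z) := by
  obtain ⟨n₁, n₂, k⟩ := z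
  by_cases hk : 0 < (k : ℕ) <;> fin_cases i
  · simp [qiMove, totalMove, qiTotal, hk]
    omega
  · simp [qiMove, totalMove, qiTotal, hk]
    omega
  · by_cases hn : 0 < n₁ + n₂
    · simp only [qiMove, totalMove, qiTotal, Fin.reduceFinMk, Matrix.cons_val, hk, hn, and_self,
        if_true, Prod.mk.injEq, and_true]
      split_ifs <;> omega
    · simp only [qiMove, totalMove, qiTotal, Fin.reduceFinMk, Matrix.cons_val, hn, and_false,
        if_false]
  all_goals simp [qiMove, totalMove, qiTotal, hk]

/-- The transition rates are those of the four moves; blocked moves do not contribute because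
`z ≠ w`. -/
theorem qiRate_eq_sum {s : ℕ} (hsb : s < b) (lam₁ lam₂ mu nu : ℝ) {z w : QIState b}
    (hzw : z ≠ w) : qiRate b s lam₁ lam₂ mu nu 1 z w =
      ∑ i, ![lam₁, lam₂, mu, nu] i * (if qiMove b i z = w then 1 else 0) := by
  obtain ⟨n₁, n₂, k⟩ := z
  obtain ⟨m₁, m₂, l⟩ := w
  have hk := k.is_lt
  have hl := l.is_lt
  have hne : ¬ (n₁ = m₁ ∧ n₂ = m₂ ∧ (k : ℕ) = l) := by
    simpa [Prod.ext_iff, Fin.ext_iff] using hzw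
  have h0 : qiMove b 0 (n₁, n₂, k) = (m₁, m₂, l) ↔
      (m₁ = n₁ + 1 ∧ m₂ = n₂ ∧ (l : ℕ) = k) ∧ 0 < (k : ℕ) := by
    simp only [qiMove, Matrix.cons_val, Prod.mk.injEq, Fin.ext_iff]
    split_ifs <;> omega
  have h1 : qiMove b 1 (n₁, n₂, k) = (m₁, m₂, l) ↔
      (m₁ = n₁ ∧ m₂ = n₂ + 1 ∧ (l : ℕ) = k) ∧ 0 < (k : ℕ) := by
    simp only [qiMove, Matrix.cons_val, Prod.mk.injEq, Fin.ext_iff]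
    split_ifs <;> omega
  have h2 : qiMove b 2 (n₁, n₂, k) = (m₁, m₂, l) ↔
      (m₁ + 1 = n₁ ∧ m₂ = n₂ ∧ (l : ℕ) + 1 = k) ∨
        (m₁ = n₁ ∧ m₂ + 1 = n₂ ∧ (l : ℕ) + 1 = k) ∧ n₁ = 0 := by
    simp only [qiMove, Matrix.cons_val]
    split_ifs <;> simp only [stockDown, Prod.mk.injEq, Fin.ext_iff] <;> omega
  have h3 : qiMove b 3 (n₁, n₂, k) = (m₁, m₂, l) ↔ m₁ = n₁ ∧ m₂ = n₂ ∧ (l : ℕ) = k + 1 := by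
    simp only [qiMove, Matrix.cons_val, Prod.mk.injEq, Fin.ext_iff, stockUp]
    omega
  rw [Fin.sum_univ_four]
  simp only [h0, h1, h2, h3, qiRate, Fin.ext_iff, Matrix.cons_val]
  by_cases c1 : m₁ = n₁ + 1 ∧ m₂ = n₂ ∧ (l : ℕ) = k
  · obtain ⟨rfl, rfl, hlk⟩ := c1
    simp [hlk]
  by_cases c2 : m₁ = n₁ ∧ m₂ = n₂ + 1 ∧ (l : ℕ) = k
  · obtain ⟨rfl, rfl, hlk⟩ := c2
    simp only [hlk]
    rcases Nat.eq_zero_or_pos (k : ℕ) with h | h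
    · simp [h]
    · by_cases hs : (k : ℕ) ≤ s
      · simp [h, hs, hs.not_gt]
      · simp [h, hs, not_le.1 hs]
  by_cases c3 : m₁ + 1 = n₁ ∧ m₂ = n₂ ∧ (l : ℕ) + 1 = k
  · obtain ⟨rfl, rfl, hlk⟩ := c3
    have : (l : ℕ) ≠ k + 1 := by omega
    simp [← hlk]
  by_cases c4 : m₁ = n₁ ∧ m₂ + 1 = n₂ ∧ (l : ℕ) + 1 = k
  · obtain ⟨rfl, rfl, hlk⟩ := c4
    simp [← hlk]
  simp [c1, c2, c3, c4]

theorem qiGenerator_eq_sum {s : ℕ} (hsb : s < b) (lam₁ lam₂ mu nu : ℝ) (z w : QIState b) :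
    qiGenerator b s lam₁ lam₂ mu nu 1 z w = ∑ i, ![lam₁, lam₂, mu, nu] i *
      ((if qiMove b i z = w then 1 else 0) - if z = w then 1 else 0) := by
  unfold qiGenerator
  split_ifs with hzw
  · subst hzw
    have h1 : ∀ i, HasSum (fun v : {v : QIState b // v ≠ z} =>
        ![lam₁, lam₂, mu, nu] i * (if qiMove b i z = v then 1 else 0))
        (![lam₁, lam₂, mu, nu] i * (if qiMove b i z = z then 0 else 1)) := by
      intro i
      refine HasSum.mul_left _ ?_
      split_ifs with h
      · convert hasSum_zero with v
        rw [if_neg]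
        rw [h]
        exact v.2.symm
      · have h2 := hasSum_single (f := fun v : {v : QIState b // v ≠ z} =>
          if qiMove b i z = v then (1 : ℝ) else 0) ⟨qiMove b i z, h⟩ fun v hv => if_neg fun hc =>
            hv (Subtype.ext hc.symm)
        simpa using h2
    have h2 := hasSum_sum fun i (_ : i ∈ Finset.univ) => h1 i
    have h3 : ∀ v : {v : QIState b // v ≠ z}, qiRate b s lam₁ lam₂ mu nu 1 z v =
        ∑ i, ![lam₁, lam₂, mu, nu] i * (if qiMove b i z = v then 1 else 0) :=
      fun v => qiRate_eq_sum hsb _ _ _ _ v.2.symm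
    simp_rw [h3]
    rw [h2.tsum_eq, ← Finset.sum_neg_distrib]
    refine Finset.sum_congr rfl fun i _ => ?_
    split_ifs <;> ring
  · simp only [sub_zero]
    exact qiRate_eq_sum hsb _ _ _ _ hzw

end Moves

/-! ### Product-form equilibrium of total and inventory -/

section Equilibrium

variable {b : ℕ}

/-- With empty stock only the replenishment part of the generator is present. -/
theorem totalGenerator_zero (lam₁ lam₂ mu nu : ℝ) (g : ℕ × Fin (b + 1) → ℝ) (n : ℕ) :
    jumpGenerator ![lam₁, lam₂, mu, nu] (totalMove b) g (n, 0) -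
      nu * (g (n, stockUp 0) - g (n, 0)) = 0 := by
  simp [jumpGenerator, Fin.sum_univ_four, totalMove]

/-- The arrival and service part of the generator at positive inventory. -/
theorem totalGenerator_succ (lam₁ lam₂ mu nu : ℝ) (g : ℕ × Fin (b + 1) → ℝ) (n : ℕ) (j : Fin b) :
    jumpGenerator ![lam₁, lam₂, mu, nu] (totalMove b) g (n, j.succ) -
        nu * (g (n, stockUp j.succ) - g (n, j.succ)) =
      (lam₁ + lam₂) * (g (n + 1, j.succ) - g (n, j.succ)) +
      (if 0 < n then mu * (g (n - 1, j.castSucc) - g (n, j.succ)) else 0) := by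
  simp only [jumpGenerator, Fin.sum_univ_four, totalMove, Matrix.cons_val, stockDown_succ,
    Fin.val_succ, Nat.succ_pos, if_true, true_and]
  split_ifs <;> ring

/-- The product-form balance equation, summed over the inventory: with weights `ρ ^ n * θ ^ k`,
where `ρ = (lam₁ + lam₂) / mu` and `θ = nu / (lam₁ + lam₂)`, the generator of the pair
(total, inventory) integrates to a telescoping sum over the total. -/
theorem sum_weight_mul_totalGenerator {lam₁ lam₂ mu nu : ℝ} (hlam : 0 < lam₁ + lam₂)
    (hmu : 0 < mu) (g : ℕ × Fin (b + 1) → ℝ) (N : ℕ) :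
    ∑ n ∈ Finset.range N, ∑ k : Fin (b + 1),
      (((lam₁ + lam₂) / mu) ^ n * (nu / (lam₁ + lam₂)) ^ (k : ℕ)) *
        jumpGenerator ![lam₁, lam₂, mu, nu] (totalMove b) g (n, k) =
    mu * ((lam₁ + lam₂) / mu) ^ N * ∑ j : Fin b, (nu / (lam₁ + lam₂)) ^ ((j : ℕ) + 1) *
      ((if 0 < N then g (N, j.succ) - g (N - 1, j.castSucc) else 0)) := by
  set lam := lam₁ + lam₂ with hlam_def
  set θ := nu / lam with hθ
  have hθnu : ∀ j : ℕ, θ ^ j * nu = θ ^ (j + 1) * lam := fun j => by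
    rw [pow_succ, mul_assoc, hθ, div_mul_cancel₀ _ hlam.ne']
  have hρmu : ∀ n : ℕ, mu * (lam / mu) ^ (n + 1) = (lam / mu) ^ n * lam := fun n => by
    rw [pow_succ]
    field_simp
  -- The balance equation for a fixed total.
  have hlevel : ∀ n, ∑ k : Fin (b + 1), θ ^ (k : ℕ) *
      jumpGenerator ![lam₁, lam₂, mu, nu] (totalMove b) g (n, k) =
      ∑ j : Fin b, θ ^ ((j : ℕ) + 1) * (lam * (g (n + 1, j.succ) - g (n, j.castSucc)) -
        (if 0 < n then mu * (g (n, j.succ) - g (n - 1, j.castSucc)) else 0)) := by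
    intro n
    have h1 : ∑ k : Fin (b + 1), θ ^ (k : ℕ) * (nu * (g (n, stockUp k) - g (n, k))) =
        ∑ j : Fin b, θ ^ ((j : ℕ) + 1) * (lam * (g (n, j.succ) - g (n, j.castSucc))) := by
      rw [Fin.sum_univ_castSucc, stockUp_last, sub_self, mul_zero, mul_zero, add_zero]
      refine Finset.sum_congr rfl fun j _ => ?_
      rw [stockUp_castSucc, ← mul_assoc, ← mul_assoc, Fin.val_castSucc, hθnu]
    have h2 : ∑ k : Fin (b + 1), θ ^ (k : ℕ) *
        (jumpGenerator ![lam₁, lam₂, mu, nu] (totalMove b) g (n, k) -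
          nu * (g (n, stockUp k) - g (n, k))) =
        ∑ j : Fin b, θ ^ ((j : ℕ) + 1) * (lam * (g (n + 1, j.succ) - g (n, j.succ)) +
          (if 0 < n then mu * (g (n - 1, j.castSucc) - g (n, j.succ)) else 0)) := by
      rw [Fin.sum_univ_succ, totalGenerator_zero, mul_zero, zero_add]
      exact Finset.sum_congr rfl fun j _ => by rw [totalGenerator_succ, Fin.val_succ]
    calc _ = ∑ k : Fin (b + 1), θ ^ (k : ℕ) *
          (jumpGenerator ![lam₁, lam₂, mu, nu] (totalMove b) g (n, k) -
            nu * (g (n, stockUp k) - g (n, k))) +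
          ∑ k : Fin (b + 1), θ ^ (k : ℕ) * (nu * (g (n, stockUp k) - g (n, k))) := by
          rw [← Finset.sum_add_distrib]
          exact Finset.sum_congr rfl fun k _ => by ring
      _ = _ := by
          rw [h1, h2, ← Finset.sum_add_distrib]
          refine Finset.sum_congr rfl fun j _ => ?_
          split_ifs <;> ring
  induction N with
  | zero => simp
  | succ N ih =>
    simp_rw [mul_assoc, ← Finset.mul_sum] at ih ⊢
    rw [Finset.sum_range_succ, ih, hlevel, ← mul_assoc mu (_ ^ N), ← mul_assoc mu (_ ^ (N + 1)),
      hρmu]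
    simp only [Finset.mul_sum, ← Finset.sum_add_distrib, Nat.succ_pos, if_true,
      Nat.add_sub_cancel]
    refine Finset.sum_congr rfl fun j _ => ?_
    split_ifs <;> ring

/-- The product-form weight `ρ ^ n * θ ^ k` of the total `n` and the inventory `k`. -/
noncomputable def totalWeight (b : ℕ) (ρ θ : ℝ) (q : ℕ × Fin (b + 1)) : ℝ :=
  ρ ^ q.1 * θ ^ (q.2 : ℕ)

theorem totalWeight_pos {ρ θ : ℝ} (hρ0 : 0 < ρ) (hθ0 : 0 < θ) (q : ℕ × Fin (b + 1)) :
    0 < totalWeight b ρ θ q :=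
  mul_pos (pow_pos hρ0 _) (pow_pos hθ0 _)

theorem summable_totalWeight {ρ θ : ℝ} (hρ0 : 0 < ρ) (hρ1 : ρ < 1) (hθ0 : 0 < θ) :
    Summable (totalWeight b ρ θ) := by
  have h1 : Summable fun k : Fin (b + 1) => θ ^ (k : ℕ) := (hasSum_fintype _).summable
  exact (summable_geometric_of_lt_one hρ0.le hρ1).mul_of_nonneg h1
    (fun n => (pow_pos hρ0 n).le) fun k => (pow_pos hθ0 (k : ℕ)).le

/-- The weights stay summable when each total `n` is counted once for each of the `n + 1` ways of
splitting it into the two classes. -/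
theorem summable_totalWeight_qiTotal {ρ θ : ℝ} (hρ0 : 0 < ρ) (hρ1 : ρ < 1) (hθ0 : 0 < θ) :
    Summable fun z : QIState b => totalWeight b ρ θ (qiTotal b z) := by
  have h1 : Summable fun z : QIState b => ρ ^ z.1 * totalWeight b ρ θ z.2 :=
    (summable_geometric_of_lt_one hρ0.le hρ1).mul_of_nonneg (summable_totalWeight hρ0 hρ1 hθ0)
      (fun n => (pow_pos hρ0 n).le) fun q => (totalWeight_pos hρ0 hθ0 q).le
  refine h1.congr fun z => ?_
  simp only [totalWeight, qiTotal, pow_add, mul_assoc]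

theorem tsum_totalWeight_mul_totalGenerator {lam₁ lam₂ mu nu : ℝ} (hlam₁ : 0 < lam₁)
    (hlam₂ : 0 < lam₂) (hmu : 0 < mu) (hnu : 0 < nu) (hlt : lam₁ + lam₂ < mu)
    {g : ℕ × Fin (b + 1) → ℝ} {B : ℝ} (hB : ∀ q, |g q| ≤ B) :
    ∑' q, totalWeight b ((lam₁ + lam₂) / mu) (nu / (lam₁ + lam₂)) q *
      jumpGenerator ![lam₁, lam₂, mu, nu] (totalMove b) g q = 0 := by
  have hlam : 0 < lam₁ + lam₂ := add_pos hlam₁ hlam₂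
  have hρ0 : 0 < (lam₁ + lam₂) / mu := div_pos hlam hmu
  have hρ1 : (lam₁ + lam₂) / mu < 1 := (div_lt_one hmu).2 hlt
  have hθ0 : 0 < nu / (lam₁ + lam₂) := div_pos hnu hlam
  have hr : ∀ i, 0 ≤ ![lam₁, lam₂, mu, nu] i := by
    intro i
    fin_cases i
    exacts [hlam₁.le, hlam₂.le, hmu.le, hnu.le]
  have hLB := abs_jumpGenerator_le (τ := totalMove b) hr hB
  have hpartial := sum_weight_mul_totalGenerator (nu := nu) hlam hmu g
  generalize jumpGenerator ![lam₁, lam₂, mu, nu] (totalMove b) g = L at hLB hpartial ⊢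
  generalize (lam₁ + lam₂) / mu = ρ at hρ0 hρ1 hpartial ⊢
  generalize nu / (lam₁ + lam₂) = θ at hθ0 hpartial ⊢
  have hsum : Summable fun q => totalWeight b ρ θ q * L q := by
    refine Summable.of_norm_bounded ((summable_totalWeight hρ0 hρ1 hθ0).mul_right
      (2 * B * ∑ i, ![lam₁, lam₂, mu, nu] i)) fun q => ?_
    rw [norm_mul, Real.norm_of_nonneg (totalWeight_pos hρ0 hθ0 q).le]
    exact mul_le_mul_of_nonneg_left (hLB q) (totalWeight_pos hρ0 hθ0 q).le
  rw [hsum.tsum_prod]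
  simp_rw [tsum_fintype]
  have h1 : Summable fun n => ∑ k, totalWeight b ρ θ (n, k) * L (n, k) := by
    simpa only [tsum_fintype] using hsum.prod
  refine tendsto_nhds_unique h1.hasSum.tendsto_sum_nat ?_
  simp only [totalWeight, hpartial]
  have h2 := ((tendsto_pow_atTop_nhds_zero_of_lt_one hρ0.le hρ1).const_mul mu).mul_const
    (∑ j : Fin b, θ ^ ((j : ℕ) + 1) * (2 * B))
  rw [mul_zero, zero_mul] at h2
  refine squeeze_zero_norm (fun N => ?_) h2
  have hN : 0 ≤ mu * ρ ^ N := mul_nonneg hmu.le (pow_pos hρ0 N).le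
  rw [norm_mul, Real.norm_of_nonneg hN]
  refine mul_le_mul_of_nonneg_left ?_ hN
  refine (norm_sum_le _ _).trans (Finset.sum_le_sum fun j _ => ?_)
  rw [norm_mul, Real.norm_of_nonneg (pow_pos hθ0 _).le]
  refine mul_le_mul_of_nonneg_left ?_ (pow_pos hθ0 _).le
  have hB0 : 0 ≤ B := (abs_nonneg _).trans (hB (0, 0))
  split_ifs
  · exact (abs_sub _ _).trans (by linarith [hB (N, j.succ), hB (N - 1, j.castSucc)])
  · simpa using hB0

theorem exists_totalMove_equilibrium {lam₁ lam₂ mu nu : ℝ} (hlam₁ : 0 < lam₁) (hlam₂ : 0 < lam₂)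
    (hmu : 0 < mu) (hnu : 0 < nu) (hlt : lam₁ + lam₂ < mu) :
    ∃ m : Measure (ℕ × Fin (b + 1)), IsProbabilityMeasure m ∧
      (∀ (g : ℕ × Fin (b + 1) → ℝ) (B : ℝ), (∀ q, |g q| ≤ B) →
        ∫ q, jumpGenerator ![lam₁, lam₂, mu, nu] (totalMove b) g q ∂m = 0) ∧
      Summable fun z : QIState b => m.real {qiTotal b z} := by
  have hlam : 0 < lam₁ + lam₂ := add_pos hlam₁ hlam₂
  have hρ0 : 0 < (lam₁ + lam₂) / mu := div_pos hlam hmu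
  have hρ1 : (lam₁ + lam₂) / mu < 1 := (div_lt_one hmu).2 hlt
  have hθ0 : 0 < nu / (lam₁ + lam₂) := div_pos hnu hlam
  have hr : ∀ i, 0 ≤ ![lam₁, lam₂, mu, nu] i := by
    intro i
    fin_cases i
    exacts [hlam₁.le, hlam₂.le, hmu.le, hnu.le]
  set u := totalWeight b ((lam₁ + lam₂) / mu) (nu / (lam₁ + lam₂)) with hu
  have hus : Summable u := summable_totalWeight hρ0 hρ1 hθ0
  have hu0 : ∀ q, 0 ≤ u q := fun q => (totalWeight_pos hρ0 hθ0 q).le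
  have hS : 0 < ∑' q, u q := hus.tsum_pos hu0 (0, 0) (totalWeight_pos hρ0 hθ0 _)
  have hw1 : HasSum (fun q => u q / ∑' q, u q) 1 := by
    simpa only [div_self hS.ne'] using hus.hasSum.div_const (∑' q, u q)
  obtain ⟨m, hm, hmw⟩ := exists_measure_real_singleton (fun q => div_nonneg (hu0 q) hS.le) hw1
  refine ⟨m, hm, fun g B hB => ?_, ?_⟩
  · rw [integral_countable (integrable_of_abs_le (abs_jumpGenerator_le hr hB))]
    have h1 : ∀ q, m.real {q} • jumpGenerator ![lam₁, lam₂, mu, nu] (totalMove b) g q =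
        (u q * jumpGenerator ![lam₁, lam₂, mu, nu] (totalMove b) g q) / ∑' q, u q := fun q => by
      rw [hmw, smul_eq_mul, div_mul_eq_mul_div]
    simp_rw [h1]
    rw [tsum_div_const, tsum_totalWeight_mul_totalGenerator hlam₁ hlam₂ hmu hnu hlt hB, zero_div]
  · simp only [hmw]
    exact (summable_totalWeight_qiTotal hρ0 hρ1 hθ0).div_const _

end Equilibrium

/-! ### Reachability -/

section Reachability

variable {b : ℕ}

/-- `QIReach b x y`: the state `y` can be reached from `x` by moves of the process. -/
abbrev QIReach (b : ℕ) : QIState b → QIState b → Prop :=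
  Relation.ReflTransGen fun x y => ∃ i, y = qiMove b i x

theorem qiReach_last (n₁ n₂ : ℕ) (k : Fin (b + 1)) :
    QIReach b (n₁, n₂, k) (n₁, n₂, Fin.last b) := by
  induction k using Fin.reverseInduction with
  | last => exact .refl
  | cast j ih =>
    refine .head ⟨3, ?_⟩ ih
    simp [qiMove, stockUp_castSucc]

theorem qiReach_origin (hb : 0 < b) (n₁ n₂ : ℕ) (k : Fin (b + 1)) :
    QIReach b (n₁, n₂, k) (0, 0, Fin.last b) := by
  refine (qiReach_last n₁ n₂ k).trans ?_
  induction hn : n₁ + n₂ generalizing n₁ n₂ with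
  | zero =>
    obtain ⟨rfl, rfl⟩ := Nat.add_eq_zero_iff.1 hn
    exact .refl
  | succ n ih =>
    have h1 : qiMove b 2 (n₁, n₂, Fin.last b) =
        (n₁ - 1, if n₁ = 0 then n₂ - 1 else n₂, stockDown (Fin.last b)) := by
      simp [qiMove, hb, hn]
    refine .head ⟨2, h1.symm⟩ ((qiReach_last _ _ _).trans (ih _ _ ?_))
    split_ifs <;> omega

/-- To reach inventory `k` from full stock, `b - k` extra priority customers are admitted and then
served. -/
theorem qiReach_of_origin (hb : 0 < b) (n₁ n₂ : ℕ) (k : Fin (b + 1)) :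
    QIReach b (0, 0, Fin.last b) (n₁, n₂, k) := by
  induction k using Fin.reverseInduction generalizing n₁ n₂ with
  | last =>
    induction n₁ with
    | zero =>
      induction n₂ with
      | zero => exact .refl
      | succ n₂ ih => exact ih.tail ⟨1, by simp [qiMove, hb]⟩
    | succ n₁ ih => exact ih.tail ⟨0, by simp [qiMove, hb]⟩
  | cast j ih =>
    -- One more priority customer and one more item are consumed by a service.
    exact (ih (n₁ + 1) n₂).tail ⟨2, by simp [qiMove, stockDown_succ]⟩

theorem qiReach (hb : 0 < b) (x y : QIState b) : QIReach b x y :=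
  (qiReach_origin hb x.1 x.2.1 x.2.2).trans (qiReach_of_origin hb y.1 y.2.1 y.2.2)

end Reachability

/-! ### The ergodicity criterion -/

/-- In equilibrium, the flow from totals `≤ n` to totals `> n` balances the flow back, so the
probabilities `A n` of the events `total = n, inventory > 0` satisfy
`(lam₁ + lam₂) * A n = mu * A (n + 1)`. They tend to `0`, which is impossible for
`mu ≤ lam₁ + lam₂` when `A 0 > 0`. -/
theorem lam_lt_mu_of_equilibrium {b : ℕ} (hb : 0 < b) {lam₁ lam₂ mu nu : ℝ} (hmu : 0 < mu)
    {μ : Measure (QIState b)} [IsProbabilityMeasure μ]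
    (hμ : ∀ (f : QIState b → ℝ) (B : ℝ), (∀ z, |f z| ≤ B) →
      ∫ z, jumpGenerator ![lam₁, lam₂, mu, nu] (qiMove b) f z ∂μ = 0)
    (hpos : ∀ z, 0 < μ.real {z}) : lam₁ + lam₂ < mu := by
  let S : ℕ → Set (QIState b) := fun n => {z | z.1 + z.2.1 = n ∧ 0 < (z.2.2 : ℕ)}
  have hS : ∀ n, MeasurableSet (S n) := fun n => MeasurableSet.of_discrete
  have hcut : ∀ n, (lam₁ + lam₂) * μ.real (S n) = mu * μ.real (S (n + 1)) := by
    intro n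
    have h1 := hμ (fun z => if z.1 + z.2.1 ≤ n then 1 else 0) 1 fun z => by
      split_ifs <;> simp
    have h2 : ∀ z, jumpGenerator ![lam₁, lam₂, mu, nu] (qiMove b)
        (fun z => if z.1 + z.2.1 ≤ n then 1 else 0) z =
        mu * (S (n + 1)).indicator 1 z - (lam₁ + lam₂) * (S n).indicator 1 z := by
      rintro ⟨n₁, n₂, k⟩
      have hserve : qiMove b 2 (n₁, n₂, k) = if 0 < (k : ℕ) ∧ 0 < n₁ + n₂ then
          (n₁ - 1, if n₁ = 0 then n₂ - 1 else n₂, stockDown k) else (n₁, n₂, k) := rfl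
      have hsplit : ((n₁ - 1) + if n₁ = 0 then n₂ - 1 else n₂) = n₁ + n₂ - 1 := by
        split_ifs <;> omega
      simp only [jumpGenerator, Fin.sum_univ_four, hserve]
      by_cases hk : 0 < (k : ℕ)
      · by_cases hn : 0 < n₁ + n₂
        · simp only [qiMove, Matrix.cons_val, hk, hn, if_true, and_self, hsplit,
            Set.indicator_apply, S, Set.mem_ofPred_eq, and_true, Pi.one_apply]
          split_ifs <;> first | omega | ring
        · simp only [qiMove, Matrix.cons_val, hk, hn, if_true, and_false, if_false,
            Set.indicator_apply, S, Set.mem_ofPred_eq, and_true, Pi.one_apply]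
          split_ifs <;> first | omega | ring
      · simp only [qiMove, Matrix.cons_val, hk, if_false, false_and, and_false,
          Set.indicator_apply, S, Set.mem_ofPred_eq]
        simp
    have hi : ∀ n, Integrable ((S n).indicator (1 : QIState b → ℝ)) μ := fun n =>
      (integrable_const (1 : ℝ)).indicator (hS n)
    simp_rw [h2] at h1
    rw [integral_sub ((hi _).const_mul _) ((hi _).const_mul _), integral_const_mul,
      integral_const_mul, integral_indicator_one (hS _), integral_indicator_one (hS _)] at h1
    linarith
  by_contra! hle
  have hmono : ∀ n, μ.real (S 0) ≤ μ.real (S n) := by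
    intro n
    induction n with
    | zero => exact le_rfl
    | succ n ih =>
      refine ih.trans (le_of_mul_le_mul_left ?_ hmu)
      rw [← hcut]
      exact mul_le_mul_of_nonneg_right hle measureReal_nonneg
  have hlim : Tendsto (fun n => μ.real (S n)) atTop (𝓝 0) := by
    refine (summable_measure_toReal hS fun i j hij => ?_).tendsto_atTop_zero
    exact Set.disjoint_left.2 fun z h1 h2 => hij (h1.1.symm.trans h2.1)
  have h0 : 0 < μ.real (S 0) := (hpos (0, 0, Fin.last b)).trans_le
    (measureReal_mono (Set.singleton_subset_iff.2 ⟨rfl, hb⟩))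
  exact (ge_of_tendsto' hlim hmono).not_gt h0

theorem mainTheorem2 (b s : ℕ) (hb : 2 ≤ b) (hs : 0 < s) (hsb : s < b)
    (lam₁ lam₂ mu nu : ℝ) (hlam₁ : 0 < lam₁) (hlam₂ : 0 < lam₂) (hmu : 0 < mu) (hnu : 0 < nu)
    {Ω : Type*} [MeasurableSpace Ω] (P : QIState b → Measure Ω) (Z : ℝ≥0 → Ω → QIState b)
    (hZ : IsMarkovJumpProcess (qiGenerator b s lam₁ lam₂ mu nu 1) P Z) :
    IsErgodicProcess P Z ↔ lam₁ + lam₂ < mu := by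
  have hb0 : 0 < b := by omega
  have hr : ∀ i, 0 < ![lam₁, lam₂, mu, nu] i := by
    intro i
    fin_cases i <;> assumption
  have hκ : IsJumpSemigroup ![lam₁, lam₂, mu, nu] (qiMove b) (transitionKernel P Z) :=
    isJumpSemigroup_transitionKernel hZ (fun i => (hr i).le)
      (qiGenerator_eq_sum hsb lam₁ lam₂ mu nu)
  have := hκ.markov
  have hpos : ∀ t, 0 < t → ∀ x y, 0 < (transitionKernel P Z t x).real {y} :=
    fun t ht x y => hκ.apply_pos_of_reflTransGen hr (qiReach hb0 x y) ht
  constructor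
  · rintro ⟨-, π, hπ, -⟩
    have hinv : ∀ t, (transitionKernel P Z t).Invariant π.toMeasure := by
      intro t
      refine Measure.ext_of_singleton fun y => ?_
      rw [Measure.bind_apply (MeasurableSet.singleton y) (Kernel.aemeasurable _),
        lintegral_countable', π.toMeasure_apply_singleton y (MeasurableSet.singleton y), ← hπ t y]
      refine tsum_congr fun x => ?_
      rw [π.toMeasure_apply_singleton x (MeasurableSet.singleton x), transitionKernel_singleton hZ,
        mul_comm]
    exact lam_lt_mu_of_equilibrium hb0 hmu
      (fun f B hB => hκ.integral_jumpGenerator_eq_zero hinv hB)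
      (real_singleton_pos_of_invariant (hpos 1 one_pos) (hinv 1))
  · intro hlt
    obtain ⟨m, hm, hm0, hmD⟩ := exists_totalMove_equilibrium (b := b) hlam₁ hlam₂ hmu hnu hlt
    obtain ⟨μ, hμ, hμ0⟩ := exists_integral_jumpGenerator_eq_zero (sec := fun q => (q.1, 0, q.2))
      (fun i => (hr i).le) (Finset.sum_pos (fun i _ => hr i) Finset.univ_nonempty)
      (fun q => rfl) qiTotal_qiMove hm0 hmD
    have hinv := hκ.invariant_of_integral_jumpGenerator_eq_zero hμ0
    refine ⟨fun x y => ⟨1, ?_⟩, μ.toPMF, fun t y => ?_, fun x y => ?_⟩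
    · have h1 := hpos 1 one_pos x y
      rw [measureReal_def, transitionKernel_singleton hZ] at h1
      exact (ENNReal.toReal_pos_iff.1 h1).1
    · have h1 := congrArg (fun ν : Measure (QIState b) => ν {y}) (hinv t).def
      rw [Measure.bind_apply (MeasurableSet.singleton y) (Kernel.aemeasurable _),
        lintegral_countable'] at h1
      rw [Measure.toPMF_apply, ← h1]
      refine tsum_congr fun x => ?_
      rw [Measure.toPMF_apply, transitionKernel_singleton hZ, mul_comm]
    · have h1 := hκ.tendsto_apply hpos hinv x y
      simp only [measureReal_def] at h1
      have h2 := (ENNReal.tendsto_toReal_iff (fun t => measure_ne_top _ _)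
        (measure_ne_top _ _)).1 h1
      simpa only [transitionKernel_singleton hZ, Measure.toPMF_apply] using h2
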